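/- **Setting.** Let $d\ge 4$ and let $M$ be a connected $(d-1)$-dimensional smooth manifold (Hausdorff, second countable) with a Riemannian metric $h$. Let $G_d>0$, $\epsilon=\pm1$, let $a,b,c$ be real constants, and let $S_{d-2}=2\pi^{(d-1)/2}/\Gamma((d-1)/2)$ be the area of the unit $(d-2)$-sphere. Let $W,\phi,\rho_m,\rho_e,p$ be real functions on $M$. We say that $(h,W,\phi,\rho_m,\rho_e,p)$ is a *static charged perfect fluid* on an open set $U\subseteq M$ if $W>0$ on $U$, the fields $h,W,\phi$ are $C^2$ on $U$, and the spacetime $\mathbb R\times U$ with metric $g=-W^2dt^2+h_{ij}dx^idx^j$, gauge field $A_\mu=-\phi\,\delta^0_\mu$ and fluid velocity $U_\mu=-W\delta^0_\mu$ satisfies the Einstein–Maxwell equations $$R_{\mu\nu}-\tfrac12 g_{\mu\nu}R=\tfrac{d-2}{d-3}\,S_{d-2}G_d\,(T_{\mu\nu}+E_{\mu\nu}),\qquad \nabla_\nu F^{\mu\nu}=S_{d-2}\,\rho_e U^\mu ,$$ where $F_{\mu\nu}=\nabla_\mu A_\nu-\nabla_\nu A_\mu$, $\;T_{\mu\nu}=(\rho_m+p)U_\mu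 U_\nu+p\,g_{\mu\nu}$ and $S_{d-2}E_{\mu\nu}=F_\mu{}^{\rho}F_{\nu\rho}-\tfrac14 g_{\mu\nu}F_{\rho\sigma}F^{\rho\sigma}$. Put $\rho_{em}=\dfrac{h^{ij}\partial_i\phi\,\partial_j\phi}{S_{d-2}W^2}$. **Theorem.** (i) Suppose the fields form a static charged perfect fluid on an open set $U\subseteq M$ and $W^2=a(-\epsilon\sqrt{G_d}\,\phi+b)^2+c$ everywhere on $U$. Then on $U$ $$a\,b\,\rho_e=\epsilon\sqrt{G_d}\Big[\Big(\rho_m+\tfrac{d-1}{d-3}\,p\Big)W+\phi\rho_e+(a-1)\big(\phi\rho_e-W\rho_{em}\big)\Big],\qquad(*)$$ and, in the equivalent form, $$a\,\rho_e\big(-\epsilon\sqrt{G_d}\,\phi+b\big)=\epsilon\sqrt{G_d}\Big[\rho_m+\tfrac{d-1}{d-3}\,p+(1-a)\rho_{em}\Big]W .$$ (ii) Conversely, let $\Omega\subset M$ be an open set with compact closure and nonempty boundary $\partial\Omega$ (the region enclosed by the closed surface $\partial\Omega$). Suppose the fields form a static charged perfect fluid on $\Omega$ (no singularities, holes or alien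 matter inside), $W$ and $\phi$ are continuous on $\overline\Omega$, condition $(*)$ holds on $\Omega$, and $W^2-a(-\epsilon\sqrt{G_d}\,\phi+b)^2-c=0$ on $\partial\Omega$. Then $W^2=a(-\epsilon\sqrt{G_d}\,\phi+b)^2+c$ everywhere in $\Omega$. -/

import Mathlib

open scoped Manifold ContDiff

noncomputable section

namespace EinsteinMaxwell

/-! ## Tensor calculus in a coordinate system

`ι` is the finite set of coordinate labels, `g x μ ν` are the components of a (pseudo-Riemannian)
metric at the coordinate point `x : ι → ℝ`. -/

section Coordinates

variable {ι : Type*} [Fintype ι] [DecidableEq ι]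

/-- Partial derivative `∂_μ f`. -/
def pd (μ : ι) (f : (ι → ℝ) → ℝ) (x : ι → ℝ) : ℝ :=
  fderiv ℝ f x (Pi.single μ 1)

/-- Inverse metric `g^{μν}`. -/
def invMetric (g : (ι → ℝ) → Matrix ι ι ℝ) (x : ι → ℝ) (μ ν : ι) : ℝ :=
  (g x)⁻¹ μ ν

/-- Christoffel symbols
`Γ^κ_{μν} = ½ g^{κσ} (∂_μ g_{νσ} + ∂_ν g_{μσ} - ∂_σ g_{μν})`. -/
def christoffel (g : (ι → ℝ) → Matrix ι ι ℝ) (κ μ ν : ι) (x : ι → ℝ) : ℝ :=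
  (1 / 2) * ∑ σ, invMetric g x κ σ *
    (pd μ (fun y => g y ν σ) x + pd ν (fun y => g y μ σ) x - pd σ (fun y => g y μ ν) x)

/-- Ricci tensor `R_{μν} = ∂_κ Γ^κ_{μν} - ∂_ν Γ^κ_{μκ} + Γ^κ_{κσ} Γ^σ_{μν} - Γ^κ_{νσ} Γ^σ_{μκ}`. -/
def ricci (g : (ι → ℝ) → Matrix ι ι ℝ) (x : ι → ℝ) (μ ν : ι) : ℝ :=
  (∑ κ, (pd κ (christoffel g κ μ ν) x - pd ν (christoffel g κ μ κ) x)) +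
    ∑ κ, ∑ σ, (christoffel g κ κ σ x * christoffel g σ μ ν x
      - christoffel g κ ν σ x * christoffel g σ μ κ x)

/-- Scalar curvature `R = g^{μν} R_{μν}`. -/
def scalarCurvature (g : (ι → ℝ) → Matrix ι ι ℝ) (x : ι → ℝ) : ℝ :=
  ∑ μ, ∑ ν, invMetric g x μ ν * ricci g x μ ν

/-- Einstein tensor `G_{μν} = R_{μν} - ½ g_{μν} R`. -/
def einsteinTensor (g : (ι → ℝ) → Matrix ι ι ℝ) (x : ι → ℝ) (μ ν : ι) : ℝ :=
  ricci g x μ ν - (1 / 2) * g x μ ν * scalarCurvature g x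

/-- Covariant derivative of a covector field, `∇_μ A_ν = ∂_μ A_ν - Γ^κ_{μν} A_κ`. -/
def covDerivCovector (g : (ι → ℝ) → Matrix ι ι ℝ) (A : (ι → ℝ) → ι → ℝ)
    (x : ι → ℝ) (μ ν : ι) : ℝ :=
  pd μ (fun y => A y ν) x - ∑ κ, christoffel g κ μ ν x * A x κ

/-- Maxwell tensor `F_{μν} = ∇_μ A_ν - ∇_ν A_μ`. -/
def maxwellTensor (g : (ι → ℝ) → Matrix ι ι ℝ) (A : (ι → ℝ) → ι → ℝ)
    (x : ι → ℝ) (μ ν : ι) : ℝ :=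
  covDerivCovector g A x μ ν - covDerivCovector g A x ν μ

/-- `F^{μν} = g^{μρ} g^{νσ} F_{ρσ}`. -/
def maxwellTensorUp (g : (ι → ℝ) → Matrix ι ι ℝ) (A : (ι → ℝ) → ι → ℝ)
    (x : ι → ℝ) (μ ν : ι) : ℝ :=
  ∑ ρ, ∑ σ, invMetric g x μ ρ * invMetric g x ν σ * maxwellTensor g A x ρ σ

/-- `∇_ν F^{μν} = ∂_ν F^{μν} + Γ^μ_{νσ} F^{σν} + Γ^ν_{νσ} F^{μσ}`. -/
def divMaxwell (g : (ι → ℝ) → Matrix ι ι ℝ) (A : (ι → ℝ) → ι → ℝ)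
    (x : ι → ℝ) (μ : ι) : ℝ :=
  (∑ ν, pd ν (fun y => maxwellTensorUp g A y μ ν) x) +
    ∑ ν, ∑ σ, (christoffel g μ ν σ x * maxwellTensorUp g A x σ ν
      + christoffel g ν ν σ x * maxwellTensorUp g A x μ σ)

/-- Electromagnetic energy-momentum tensor `E_{μν}`, where
`S E_{μν} = F_μ^ρ F_{νρ} - ¼ g_{μν} F_{ρσ} F^{ρσ}`. -/
def maxwellStress (S : ℝ) (g : (ι → ℝ) → Matrix ι ι ℝ) (A : (ι → ℝ) → ι → ℝ)
    (x : ι → ℝ) (μ ν : ι) : ℝ :=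
  (1 / S) *
    ((∑ ρ, ∑ σ, invMetric g x ρ σ * maxwellTensor g A x μ σ * maxwellTensor g A x ν ρ)
      - (1 / 4) * g x μ ν * ∑ ρ, ∑ σ, maxwellTensor g A x ρ σ * maxwellTensorUp g A x ρ σ)

/-- Perfect-fluid energy-momentum tensor `T_{μν} = (ρ_m + p) U_μ U_ν + p g_{μν}`. -/
def fluidStress (g : (ι → ℝ) → Matrix ι ι ℝ) (U : (ι → ℝ) → ι → ℝ)
    (ρm p : (ι → ℝ) → ℝ) (x : ι → ℝ) (μ ν : ι) : ℝ :=
  (ρm x + p x) * U x μ * U x ν + p x * g x μ ν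

/-- Current density `J^μ = g^{μν} J_ν`, where `J_ν = ρ_e U_ν`. -/
def currentUp (g : (ι → ℝ) → Matrix ι ι ℝ) (U : (ι → ℝ) → ι → ℝ)
    (ρe : (ι → ℝ) → ℝ) (x : ι → ℝ) (μ : ι) : ℝ :=
  ∑ ν, invMetric g x μ ν * (ρe x * U x ν)

/-- The Einstein-Maxwell equations at the coordinate point `x`, in spacetime dimension `d`
(the number of coordinates), with `S` the area of the unit `(d-2)`-sphere:
`G_{μν} = (d-2)/(d-3) S G_d (T_{μν} + E_{μν})` and `∇_ν F^{μν} = S J^μ`. -/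
def EinsteinMaxwellAt (d S Gd : ℝ) (g : (ι → ℝ) → Matrix ι ι ℝ) (A U : (ι → ℝ) → ι → ℝ)
    (ρm ρe p : (ι → ℝ) → ℝ) (x : ι → ℝ) : Prop :=
  (∀ μ ν, einsteinTensor g x μ ν =
    (d - 2) / (d - 3) * S * Gd * (fluidStress g U ρm p x μ ν + maxwellStress S g A x μ ν)) ∧
  ∀ μ, divMaxwell g A x μ = S * currentUp g U ρe x μ

end Coordinates

/-- Spacetime dimension `d = n + 1`, as a real number, for `n` space dimensions. -/
def dim (n : ℕ) : ℝ := n + 1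

/-- Area `S_{d-2} = 2 π^{(d-1)/2} / Γ((d-1)/2)` of the unit `(d-2)`-sphere, `d = n + 1`. -/
def sphereArea (n : ℕ) : ℝ :=
  2 * Real.pi ^ ((dim n - 1) / 2) / Real.Gamma ((dim n - 1) / 2)

/-! ## Static charged fluids

Space is an `n`-dimensional manifold `M` with Riemannian metric `h`; spacetime is `ℝ × M` with
metric `-W² dt² + h`.  A chart of `M` gives spacetime coordinates labelled by `Fin 1 ⊕ Fin n`, the
left summand being the time coordinate. -/

section Static

variable {n : ℕ} {M : Type*} [TopologicalSpace M] [ChartedSpace (EuclideanSpace ℝ (Fin n)) M]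
  [IsManifold (𝓡 n) ∞ M]

/-- Components `h_{ij} = h(∂_i, ∂_j)` of the spatial metric in the chart `e`. -/
def metricInChart (h : Bundle.RiemannianMetric (fun q : M => TangentSpace (𝓡 n) q))
    (e : OpenPartialHomeomorph M (EuclideanSpace ℝ (Fin n))) (y : EuclideanSpace ℝ (Fin n)) :
    Matrix (Fin n) (Fin n) ℝ :=
  Matrix.of fun i j =>
    h.inner (e.symm y)
      (mfderiv (𝓡 n) (𝓡 n) e.symm y (EuclideanSpace.single i (1 : ℝ)))
      (mfderiv (𝓡 n) (𝓡 n) e.symm y (EuclideanSpace.single j (1 : ℝ)))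

/-- Spatial coordinates of a spacetime coordinate point. -/
def spacePart (x : Fin 1 ⊕ Fin n → ℝ) : EuclideanSpace ℝ (Fin n) :=
  WithLp.toLp 2 fun i => x (Sum.inr i)

/-- A function on space, as a (time-independent) function of the spacetime coordinates. -/
def inChart (e : OpenPartialHomeomorph M (EuclideanSpace ℝ (Fin n))) (f : M → ℝ)
    (x : Fin 1 ⊕ Fin n → ℝ) : ℝ :=
  f (e.symm (spacePart x))

/-- The static metric `-W² dt² + h_{ij} dx^i dx^j`. -/
def staticMetric (h : Bundle.RiemannianMetric (fun q : M => TangentSpace (𝓡 n) q)) (W : M → ℝ)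
    (e : OpenPartialHomeomorph M (EuclideanSpace ℝ (Fin n))) (x : Fin 1 ⊕ Fin n → ℝ) :
    Matrix (Fin 1 ⊕ Fin n) (Fin 1 ⊕ Fin n) ℝ :=
  Matrix.fromBlocks (Matrix.of fun _ _ => -(inChart e W x) ^ 2) 0 0
    (metricInChart h e (spacePart x))

/-- The covector with components `f δ_μ^0`. -/
def timeCovector (e : OpenPartialHomeomorph M (EuclideanSpace ℝ (Fin n))) (f : M → ℝ)
    (x : Fin 1 ⊕ Fin n → ℝ) : Fin 1 ⊕ Fin n → ℝ :=
  Sum.elim (fun _ => inChart e f x) (fun _ => 0)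

/-- The fields `(h, W, φ, ρ_m, ρ_e, p)` describe a static charged perfect fluid solving the
Einstein-Maxwell equations over the open region `U` of space: `W > 0`, the fields `h, W, φ` are
`C²` there, and the Einstein-Maxwell equations with metric `-W² dt² + h`, gauge field
`A_μ = -φ δ_μ^0` and fluid velocity `U_μ = -W δ_μ^0` hold in every chart. -/
structure IsStaticChargedFluid (Gd : ℝ)
    (h : Bundle.RiemannianMetric (fun q : M => TangentSpace (𝓡 n) q))
    (W φ ρm ρe p : M → ℝ) (U : Set M) : Prop where
  pos : ∀ q ∈ U, 0 < W q
  contMDiffOn_W : ContMDiffOn (𝓡 n) 𝓘(ℝ, ℝ) 2 W U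
  contMDiffOn_φ : ContMDiffOn (𝓡 n) 𝓘(ℝ, ℝ) 2 φ U
  contDiffOn_h : ∀ e ∈ atlas (EuclideanSpace ℝ (Fin n)) M, ∀ i j,
    ContDiffOn ℝ 2 (fun y => metricInChart h e y i j) (e.target ∩ e.symm ⁻¹' U)
  equations : ∀ e ∈ atlas (EuclideanSpace ℝ (Fin n)) M, ∀ x : Fin 1 ⊕ Fin n → ℝ,
    spacePart x ∈ e.target → e.symm (spacePart x) ∈ U →
      EinsteinMaxwellAt (dim n) (sphereArea n) Gd (staticMetric h W e)
        (timeCovector e fun q => -φ q) (timeCovector e fun q => -W q)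
        (inChart e ρm) (inChart e ρe) (inChart e p) x

/-- The gradient `∇φ` with respect to the spatial metric: `h(∇φ, v) = dφ(v)` for all `v`. -/
def spatialGradient (h : Bundle.RiemannianMetric (fun q : M => TangentSpace (𝓡 n) q))
    (φ : M → ℝ) (q : M) : TangentSpace (𝓡 n) q :=
  (h.inner q).inverse (mfderiv (𝓡 n) 𝓘(ℝ, ℝ) φ q)

/-- The electromagnetic energy density `ρ_em = (∇φ)² / (S_{d-2} W²)`. -/
def rhoEM (h : Bundle.RiemannianMetric (fun q : M => TangentSpace (𝓡 n) q))
    (W φ : M → ℝ) (q : M) : ℝ :=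
  (1 / sphereArea n) *
    (h.inner q (spatialGradient h φ q) (spatialGradient h φ q) / W q ^ 2)

end Static

end EinsteinMaxwell

end

/-! Write σ = ε√G_d, u = -φ and f = W² - a(σu + b)² - c. Only two scalar consequences of the field
equations matter. The trace-reversed time-time Einstein equation gives WΔW = S G_d W²(ρ_m +
(d-1)/(d-3) p) + G_d|∇φ|² (`laplacian_warp`), and the time component of Maxwell's equation gives Δu
= ⟨∇W, ∇u⟩/W + S ρ_e W (`laplacian_potential`).

The right operator to apply to f is Lf = Δf - ⟨∇W, ∇f⟩/W. Its drift removes both |∇W|² and ⟨∇W, ∇u⟩,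
and since σ² = G_d the remainder is Lf = 2 S W σ times the defect σ(ρ_m + (d-1)/(d-3) p + (1 -
a)ρ_em)W - a ρ_e(σu + b) of the source relation (`laplacian_sub_quadratic`, and
`ellipticOp_relationDefect` in charts of the manifold).

For (i), f vanishes on an open set, so Lf = 0, and the prefactor is nonzero because W > 0 and G_d >
0. For (ii), the source relation gives Lf = 0. In coordinates L is elliptic with continuous
coefficients and no zeroth-order term, so Hopf's strong maximum principle
(`eventually_eq_of_attains_max`) shows that f is locally constant near an interior maximum. If that
maximum were positive, its level set in the closure of Ω would avoid the boundary and be clopen in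
the connected M, contradicting the nonempty boundary (`nonpos_of_eventually_eq_at_max`). Applied to
f and to -f, this gives f = 0. -/

noncomputable section

namespace EinsteinMaxwell

open Filter Topology

/-! ### Partial derivatives of time-independent functions -/

section CoordinateDerivative

variable {n : ℕ}

/-- Partial derivative `∂_i f` on Euclidean space. -/
def coordDeriv (i : Fin n) (f : EuclideanSpace ℝ (Fin n) → ℝ) (y : EuclideanSpace ℝ (Fin n)) : ℝ :=
  fderiv ℝ f y (EuclideanSpace.single i 1)

/-- `spacePart` as a continuous linear map. -/
def spacePartL (n : ℕ) : (Fin 1 ⊕ Fin n → ℝ) →L[ℝ] EuclideanSpace ℝ (Fin n) :=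
  (EuclideanSpace.equiv (Fin n) ℝ).symm.toContinuousLinearMap ∘L
    ContinuousLinearMap.pi fun i => ContinuousLinearMap.proj (Sum.inr i)

lemma spacePartL_apply (x : Fin 1 ⊕ Fin n → ℝ) : spacePartL n x = spacePart x := rfl

/-- A spacetime point on the slice `t = 0`. -/
def sliceL (n : ℕ) : EuclideanSpace ℝ (Fin n) →L[ℝ] (Fin 1 ⊕ Fin n → ℝ) :=
  ContinuousLinearMap.pi (Sum.elim (fun _ => 0) fun i => EuclideanSpace.proj i)

lemma spacePart_sliceL (y : EuclideanSpace ℝ (Fin n)) : spacePart (sliceL n y) = y := by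
  ext i; simp [spacePart, sliceL]

lemma continuous_spacePart : Continuous (spacePart (n := n)) := (spacePartL n).continuous

/-- No differentiability is assumed: f is recovered from its pullback by restriction to a time
slice, so the two fail to be differentiable together, and then both derivatives take the default
value 0. -/
lemma fderiv_comp_spacePart (f : EuclideanSpace ℝ (Fin n) → ℝ) (x : Fin 1 ⊕ Fin n → ℝ) :
    fderiv ℝ (fun y => f (spacePart y)) x = (fderiv ℝ f (spacePart x)) ∘L spacePartL n := by
  by_cases hf : DifferentiableAt ℝ f (spacePart x)
  · exact (HasFDerivAt.comp x (g := f) (f := spacePart) hf.hasFDerivAt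
      (spacePartL n).hasFDerivAt).fderiv
  · have h2 : ¬ DifferentiableAt ℝ (fun y => f (spacePart y)) x := by
      intro hd
      apply hf
      -- z is the pure time component of x; adding it moves the slice t = 0 to the slice through x.
      let z : Fin 1 ⊕ Fin n → ℝ := x - sliceL n (spacePart x)
      have hz : spacePart z = 0 := by
        rw [← spacePartL_apply, map_sub, spacePartL_apply, spacePartL_apply, spacePart_sliceL,
          sub_self]
      have he : f = fun y => (fun y => f (spacePart y)) (sliceL n y + z) := by
        funext y
        change f y = f (spacePartL n (sliceL n y + z))
        rw [map_add, spacePartL_apply, spacePartL_apply, hz, spacePart_sliceL, add_zero]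
      rw [he]
      have hx : sliceL n (spacePart x) + z = x := by simp [z]
      refine DifferentiableAt.comp (g := fun y => f (spacePart y)) (f := fun y => sliceL n y + z)
        (spacePart x) ?_ ((sliceL n).differentiableAt.add_const z)
      simpa only [hx] using hd
    rw [fderiv_zero_of_not_differentiableAt hf, fderiv_zero_of_not_differentiableAt h2]
    rfl

lemma pd_inr_comp_spacePart (i : Fin n) (f : EuclideanSpace ℝ (Fin n) → ℝ)
    (x : Fin 1 ⊕ Fin n → ℝ) :
    pd (Sum.inr i) (fun y => f (spacePart y)) x = coordDeriv i f (spacePart x) := by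
  rw [pd, fderiv_comp_spacePart, coordDeriv, ContinuousLinearMap.comp_apply, spacePartL_apply]
  congr 1
  ext j
  by_cases hj : j = i
  · subst hj; simp [spacePart]
  · simp [spacePart, hj]

lemma pd_inl_comp_spacePart (t : Fin 1) (f : EuclideanSpace ℝ (Fin n) → ℝ)
    (x : Fin 1 ⊕ Fin n → ℝ) :
    pd (Sum.inl t) (fun y => f (spacePart y)) x = 0 := by
  rw [pd, fderiv_comp_spacePart, ContinuousLinearMap.comp_apply, spacePartL_apply]
  have : spacePart (Pi.single (Sum.inl t) (1 : ℝ) : Fin 1 ⊕ Fin n → ℝ) = 0 := by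
    ext j; simp [spacePart]
  rw [this, map_zero]

lemma pd_zero (μ : Fin 1 ⊕ Fin n) (x : Fin 1 ⊕ Fin n → ℝ) : pd μ (fun _ => 0) x = 0 := by
  simp [pd]

lemma pd_congr {ι : Type*} [Fintype ι] [DecidableEq ι] (μ : ι) {f g : (ι → ℝ) → ℝ} {x : ι → ℝ}
    (h : f =ᶠ[𝓝 x] g) : pd μ f x = pd μ g x := by
  rw [pd, h.fderiv_eq, pd]

lemma coordDeriv_congr (i : Fin n) {f g : EuclideanSpace ℝ (Fin n) → ℝ}
    {x : EuclideanSpace ℝ (Fin n)} (h : f =ᶠ[𝓝 x] g) : coordDeriv i f x = coordDeriv i g x := by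
  rw [coordDeriv, h.fderiv_eq, coordDeriv]

variable {f g : EuclideanSpace ℝ (Fin n) → ℝ} {y : EuclideanSpace ℝ (Fin n)}

lemma coordDeriv_const (i : Fin n) (c : ℝ) : coordDeriv i (fun _ => c) y = 0 := by
  simp [coordDeriv]

lemma coordDeriv_neg (i : Fin n) : coordDeriv i (fun z => -f z) y = -coordDeriv i f y := by
  simp [coordDeriv, fderiv_fun_neg]

lemma coordDeriv_add (i : Fin n) (hf : DifferentiableAt ℝ f y) (hg : DifferentiableAt ℝ g y) :
    coordDeriv i (fun z => f z + g z) y = coordDeriv i f y + coordDeriv i g y := by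
  simp [coordDeriv, fderiv_fun_add hf hg]

lemma coordDeriv_sub (i : Fin n) (hf : DifferentiableAt ℝ f y) (hg : DifferentiableAt ℝ g y) :
    coordDeriv i (fun z => f z - g z) y = coordDeriv i f y - coordDeriv i g y := by
  simp [coordDeriv, fderiv_fun_sub hf hg]

lemma coordDeriv_mul (i : Fin n) (hf : DifferentiableAt ℝ f y) (hg : DifferentiableAt ℝ g y) :
    coordDeriv i (fun z => f z * g z) y = f y * coordDeriv i g y + g y * coordDeriv i f y := by
  simp [coordDeriv, fderiv_fun_mul hf hg]

lemma coordDeriv_sum {ι : Type*} (s : Finset ι) (i : Fin n)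
    {F : ι → EuclideanSpace ℝ (Fin n) → ℝ} (hF : ∀ k ∈ s, DifferentiableAt ℝ (F k) y) :
    coordDeriv i (fun z => ∑ k ∈ s, F k z) y = ∑ k ∈ s, coordDeriv i (F k) y := by
  simp [coordDeriv, fderiv_fun_sum hF]

lemma coordDeriv_sq (i : Fin n) (hf : DifferentiableAt ℝ f y) :
    coordDeriv i (fun z => f z ^ 2) y = 2 * f y * coordDeriv i f y := by
  simp only [pow_two]; rw [coordDeriv_mul i hf hf]; ring

lemma coordDeriv_inv (i : Fin n) (hf : DifferentiableAt ℝ f y) (h0 : f y ≠ 0) :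
    coordDeriv i (fun z => (f z)⁻¹) y = -(coordDeriv i f y) / f y ^ 2 := by
  have := ((hasDerivAt_inv h0).comp_hasFDerivAt y hf.hasFDerivAt).fderiv
  simp only [coordDeriv]
  change fderiv ℝ (Inv.inv ∘ f) y _ = _
  rw [this]
  simp only [smul_apply, smul_eq_mul]
  ring

lemma contDiffAt_coordDeriv {k m : ℕ∞ω} (i : Fin n) (hf : ContDiffAt ℝ k f y) (hmk : m + 1 ≤ k) :
    ContDiffAt ℝ m (coordDeriv i f) y :=
  (hf.fderiv_right hmk).clm_apply contDiffAt_const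

end CoordinateDerivative

/-! ### Inverse and Christoffel symbols of a static metric -/

section WarpedMetric

variable {n : ℕ}

/-- The metric `-w² dt² + H_{ij} dx^i dx^j` in coordinates. -/
def warpedMetric (H : EuclideanSpace ℝ (Fin n) → Matrix (Fin n) (Fin n) ℝ)
    (w : EuclideanSpace ℝ (Fin n) → ℝ) (x : Fin 1 ⊕ Fin n → ℝ) :
    Matrix (Fin 1 ⊕ Fin n) (Fin 1 ⊕ Fin n) ℝ :=
  Matrix.fromBlocks (Matrix.of fun _ _ => -(w (spacePart x)) ^ 2) 0 0 (H (spacePart x))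

/-- The covector with components `f δ_μ^0`. -/
def timelike (f : EuclideanSpace ℝ (Fin n) → ℝ) (x : Fin 1 ⊕ Fin n → ℝ) : Fin 1 ⊕ Fin n → ℝ :=
  Sum.elim (fun _ => f (spacePart x)) (fun _ => 0)

/-- Christoffel symbols of the spatial metric. -/
def spatialChristoffel (H : EuclideanSpace ℝ (Fin n) → Matrix (Fin n) (Fin n) ℝ)
    (l i j : Fin n) (y : EuclideanSpace ℝ (Fin n)) : ℝ :=
  (1 / 2) * ∑ s, (H y)⁻¹ l s * (coordDeriv i (fun z => H z j s) y
    + coordDeriv j (fun z => H z i s) y - coordDeriv s (fun z => H z i j) y)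

/-- Gradient components `H^{kj} ∂_j f`. -/
def gradUp (H : EuclideanSpace ℝ (Fin n) → Matrix (Fin n) (Fin n) ℝ)
    (f : EuclideanSpace ℝ (Fin n) → ℝ) (k : Fin n) (y : EuclideanSpace ℝ (Fin n)) : ℝ :=
  ∑ j, (H y)⁻¹ k j * coordDeriv j f y

/-- `⟨∂f, ∂g⟩ = ∂_k f H^{kj} ∂_j g`. -/
def gradInner (H : EuclideanSpace ℝ (Fin n) → Matrix (Fin n) (Fin n) ℝ)
    (f g : EuclideanSpace ℝ (Fin n) → ℝ) (y : EuclideanSpace ℝ (Fin n)) : ℝ :=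
  ∑ k, coordDeriv k f y * gradUp H g k y

/-- The Laplacian `∂_k X^k + Γ^l_{lk} X^k` with `X = ∇f`. -/
def laplacian (H : EuclideanSpace ℝ (Fin n) → Matrix (Fin n) (Fin n) ℝ)
    (f : EuclideanSpace ℝ (Fin n) → ℝ) (y : EuclideanSpace ℝ (Fin n)) : ℝ :=
  (∑ k, coordDeriv k (gradUp H f k) y) +
    ∑ k, (∑ l, spatialChristoffel H l l k y) * gradUp H f k y

/-- The hypotheses at a coordinate point under which the warped metric is a `C²` static metric. -/
structure IsRegularAt (H : EuclideanSpace ℝ (Fin n) → Matrix (Fin n) (Fin n) ℝ)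
    (w : EuclideanSpace ℝ (Fin n) → ℝ) (y : EuclideanSpace ℝ (Fin n)) : Prop where
  pos : 0 < w y
  contDiffAt_w : ContDiffAt ℝ 2 w y
  contDiffAt_H : ∀ i j, ContDiffAt ℝ 2 (fun z => H z i j) y
  posDef : (H y).PosDef

variable {H : EuclideanSpace ℝ (Fin n) → Matrix (Fin n) (Fin n) ℝ}
  {w : EuclideanSpace ℝ (Fin n) → ℝ} {x : Fin 1 ⊕ Fin n → ℝ}

lemma warpedMetric_inv (hr : IsRegularAt H w (spacePart x)) :
    (warpedMetric H w x)⁻¹ =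
      Matrix.fromBlocks (Matrix.of fun _ _ => -((w (spacePart x)) ^ 2)⁻¹) 0 0
        (H (spacePart x))⁻¹ := by
  have hw := hr.pos.ne'
  have h2 := hr.posDef.isUnit
  have h3 := (Matrix.isUnit_iff_isUnit_det _).1 h2
  apply Matrix.inv_eq_right_inv
  rw [warpedMetric, Matrix.fromBlocks_multiply, Matrix.mul_nonsing_inv _ h3]
  simp only [Matrix.zero_mul, Matrix.mul_zero, add_zero, zero_add]
  rw [← Matrix.fromBlocks_one]
  congr 1
  ext i j
  fin_cases i; fin_cases j
  simp [Matrix.mul_apply, hw]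

lemma invMetric_inl_inl (hr : IsRegularAt H w (spacePart x)) (s t : Fin 1) :
    invMetric (warpedMetric H w) x (Sum.inl s) (Sum.inl t) = -((w (spacePart x)) ^ 2)⁻¹ := by
  simp [invMetric, warpedMetric_inv hr]

lemma invMetric_inl_inr (hr : IsRegularAt H w (spacePart x)) (s : Fin 1) (i : Fin n) :
    invMetric (warpedMetric H w) x (Sum.inl s) (Sum.inr i) = 0 := by
  simp [invMetric, warpedMetric_inv hr]

lemma invMetric_inr_inl (hr : IsRegularAt H w (spacePart x)) (s : Fin 1) (i : Fin n) :
    invMetric (warpedMetric H w) x (Sum.inr i) (Sum.inl s) = 0 := by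
  simp [invMetric, warpedMetric_inv hr]

lemma invMetric_inr_inr (hr : IsRegularAt H w (spacePart x)) (i j : Fin n) :
    invMetric (warpedMetric H w) x (Sum.inr i) (Sum.inr j) = (H (spacePart x))⁻¹ i j := by
  simp [invMetric, warpedMetric_inv hr]

lemma pd_inl_warpedMetric (t : Fin 1) (μ ν : Fin 1 ⊕ Fin n) :
    pd (Sum.inl t) (fun y => warpedMetric H w y μ ν) x = 0 := by
  rcases μ with s | i <;> rcases ν with u | j
  · exact pd_inl_comp_spacePart t (fun y => -(w y) ^ 2) x
  · exact pd_zero _ x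
  · exact pd_zero _ x
  · exact pd_inl_comp_spacePart t (fun y => H y i j) x

lemma pd_warpedMetric_inl_inl (hr : IsRegularAt H w (spacePart x)) (k : Fin n) (s t : Fin 1) :
    pd (Sum.inr k) (fun y => warpedMetric H w y (Sum.inl s) (Sum.inl t)) x
      = -(2 * w (spacePart x) * coordDeriv k w (spacePart x)) := by
  have := pd_inr_comp_spacePart k (fun y => -(w y) ^ 2) x
  rw [coordDeriv_neg, coordDeriv_sq k (hr.contDiffAt_w.differentiableAt two_ne_zero)] at this
  exact this

lemma pd_warpedMetric_inl_inr (μ : Fin 1 ⊕ Fin n) (s : Fin 1) (i : Fin n) :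
    pd μ (fun y => warpedMetric H w y (Sum.inl s) (Sum.inr i)) x = 0 := pd_zero _ x

lemma pd_warpedMetric_inr_inl (μ : Fin 1 ⊕ Fin n) (s : Fin 1) (i : Fin n) :
    pd μ (fun y => warpedMetric H w y (Sum.inr i) (Sum.inl s)) x = 0 := pd_zero _ x

lemma pd_warpedMetric_inr_inr (k i j : Fin n) :
    pd (Sum.inr k) (fun y => warpedMetric H w y (Sum.inr i) (Sum.inr j)) x
      = coordDeriv k (fun z => H z i j) (spacePart x) :=
  pd_inr_comp_spacePart k (fun y => H y i j) x

section

variable (hr : IsRegularAt H w (spacePart x)) (r s t : Fin 1) (i j k : Fin n)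
include hr

/-- The metric is static, hence invariant under t ↦ -t, so in this and the following lemmas only
symbols with an even number of time indices survive. -/
lemma christoffel_inl_inl_inl :
    christoffel (warpedMetric H w) (Sum.inl r) (Sum.inl s) (Sum.inl t) x = 0 := by
  simp [christoffel, Fintype.sum_sum_type, invMetric_inl_inr hr, pd_inl_warpedMetric]

lemma christoffel_inl_inl_inr :
    christoffel (warpedMetric H w) (Sum.inl r) (Sum.inl s) (Sum.inr i) x
      = coordDeriv i w (spacePart x) / w (spacePart x) := by
  have := hr.pos.ne'
  simp [christoffel, Fintype.sum_sum_type, invMetric_inl_inr hr, invMetric_inl_inl hr,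
    pd_inl_warpedMetric, pd_warpedMetric_inl_inl hr]
  field_simp

lemma christoffel_inl_inr_inl :
    christoffel (warpedMetric H w) (Sum.inl r) (Sum.inr i) (Sum.inl s) x
      = coordDeriv i w (spacePart x) / w (spacePart x) := by
  have := hr.pos.ne'
  simp [christoffel, Fintype.sum_sum_type, invMetric_inl_inr hr, invMetric_inl_inl hr,
    pd_inl_warpedMetric, pd_warpedMetric_inl_inl hr]
  field_simp

lemma christoffel_inl_inr_inr :
    christoffel (warpedMetric H w) (Sum.inl r) (Sum.inr i) (Sum.inr j) x = 0 := by
  simp [christoffel, Fintype.sum_sum_type, invMetric_inl_inr hr, pd_inl_warpedMetric,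
    pd_warpedMetric_inr_inl]

lemma christoffel_inr_inl_inl :
    christoffel (warpedMetric H w) (Sum.inr k) (Sum.inl s) (Sum.inl t) x
      = w (spacePart x) * gradUp H w k (spacePart x) := by
  simp only [christoffel, Fintype.sum_sum_type, invMetric_inr_inl hr, invMetric_inr_inr hr,
    pd_inl_warpedMetric, pd_warpedMetric_inl_inl hr, gradUp, Finset.mul_sum]
  simp only [zero_mul, Finset.sum_const_zero, zero_add, Finset.mul_sum]
  exact Finset.sum_congr rfl fun a _ => by ring

lemma christoffel_inr_inl_inr :
    christoffel (warpedMetric H w) (Sum.inr k) (Sum.inl s) (Sum.inr j) x = 0 := by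
  simp [christoffel, Fintype.sum_sum_type, invMetric_inr_inl hr, pd_inl_warpedMetric,
    pd_warpedMetric_inl_inr]

lemma christoffel_inr_inr_inl :
    christoffel (warpedMetric H w) (Sum.inr k) (Sum.inr j) (Sum.inl s) x = 0 := by
  simp [christoffel, Fintype.sum_sum_type, invMetric_inr_inl hr, pd_inl_warpedMetric,
    pd_warpedMetric_inl_inr, pd_warpedMetric_inr_inl]

lemma christoffel_inr_inr_inr :
    christoffel (warpedMetric H w) (Sum.inr k) (Sum.inr i) (Sum.inr j) x
      = spatialChristoffel H k i j (spacePart x) := by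
  simp [christoffel, Fintype.sum_sum_type, invMetric_inr_inl hr, invMetric_inr_inr hr,
    pd_warpedMetric_inr_inr, spatialChristoffel]

end

end WarpedMetric

/-! ### Regularity and trace identities for the inverse matrix -/

section SmoothInverse

variable {E : Type*} [NormedAddCommGroup E] [NormedSpace ℝ E] {ι : Type*} [Fintype ι]
  [DecidableEq ι] {m : ℕ∞ω} {A : E → Matrix ι ι ℝ} {y : E}

lemma contDiffAt_det (hA : ∀ i j, ContDiffAt ℝ m (fun z => A z i j) y) :
    ContDiffAt ℝ m (fun z => (A z).det) y := by
  simp only [Matrix.det_apply]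
  refine ContDiffAt.sum fun σ _ => ContDiffAt.const_smul _ ?_
  exact contDiffAt_prod fun i _ => hA _ _

/-- Cramer's rule: an inverse entry is a cofactor over the determinant. The cofactor is itself the
determinant of a matrix with one row replaced by constants. -/
lemma contDiffAt_matrix_inv (hA : ∀ i j, ContDiffAt ℝ m (fun z => A z i j) y)
    (h0 : IsUnit (A y).det) (i j : ι) : ContDiffAt ℝ m (fun z => (A z)⁻¹ i j) y := by
  simp only [Matrix.inv_def, Ring.inverse_eq_inv', Matrix.smul_apply, smul_eq_mul,
    Matrix.adjugate_apply]
  refine ((contDiffAt_det hA).inv h0.ne_zero).mul (contDiffAt_det fun k l => ?_)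
  simp only [Matrix.updateRow_apply]
  split_ifs
  · exact contDiffAt_const
  · exact hA k l

lemma sum_inv_mul_self {A : Matrix ι ι ℝ} (hs : ∀ i j, A i j = A j i) (h0 : IsUnit A.det) :
    ∑ i, ∑ j, A⁻¹ i j * A i j = Fintype.card ι := by
  have h1 := congrArg Matrix.trace (Matrix.nonsing_inv_mul A h0)
  rw [Matrix.trace_one] at h1
  rw [← h1]
  simp only [Matrix.trace, Matrix.diag, Matrix.mul_apply]
  exact Finset.sum_congr rfl fun i _ => Finset.sum_congr rfl fun j _ => by rw [hs]

end SmoothInverse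

/-! ### Reduction of the Einstein–Maxwell equations to two scalar equations -/

section FieldEquations

variable {n : ℕ} {H : EuclideanSpace ℝ (Fin n) → Matrix (Fin n) (Fin n) ℝ}
  {w f : EuclideanSpace ℝ (Fin n) → ℝ} {x : Fin 1 ⊕ Fin n → ℝ} {y : EuclideanSpace ℝ (Fin n)}

lemma IsRegularAt.symm (hr : IsRegularAt H w y) (i j : Fin n) : H y i j = H y j i := by
  simpa using (hr.posDef.isHermitian.apply i j).symm

lemma IsRegularAt.isUnit_det (hr : IsRegularAt H w y) : IsUnit (H y).det :=
  (Matrix.isUnit_iff_isUnit_det _).1 hr.posDef.isUnit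

lemma contDiffAt_gradUp (hr : IsRegularAt H w y) (hf : ContDiffAt ℝ 2 f y) (k : Fin n) :
    ContDiffAt ℝ 1 (gradUp H f k) y := by
  unfold gradUp
  exact ContDiffAt.sum fun j _ => ((contDiffAt_matrix_inv hr.contDiffAt_H
    hr.isUnit_det k j).of_le one_le_two).mul (contDiffAt_coordDeriv j hf (by norm_num))

lemma differentiableAt_gradUp (hr : IsRegularAt H w y) (hf : ContDiffAt ℝ 2 f y) (k : Fin n) :
    DifferentiableAt ℝ (gradUp H f k) y :=
  (contDiffAt_gradUp hr hf k).differentiableAt one_ne_zero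

lemma eventually_spacePart {P : EuclideanSpace ℝ (Fin n) → Prop}
    (h : ∀ᶠ y in 𝓝 (spacePart x), P y) : ∀ᶠ z in 𝓝 x, P (spacePart z) :=
  continuous_spacePart.continuousAt.eventually h

/-- `R_{00} = W ΔW` for a static metric. -/
lemma ricci_inl_inl (hr : ∀ᶠ y in 𝓝 (spacePart x), IsRegularAt H w y) :
    ricci (warpedMetric H w) x (Sum.inl 0) (Sum.inl 0)
      = w (spacePart x) * laplacian H w (spacePart x) := by
  have hev := eventually_spacePart hr
  have h := hr.self_of_nhds
  -- The closed forms of the Christoffel symbols must hold on a neighbourhood before they can be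
  -- differentiated, which is why regularity is assumed eventually near the point.
  have e1 : ∀ κ, pd (Sum.inl 0) (christoffel (warpedMetric H w) κ (Sum.inl 0) κ) x = 0 := by
    rintro (s | k)
    · rw [pd_congr _ (hev.mono fun z hz => christoffel_inl_inl_inl hz _ _ _), pd_zero]
    · rw [pd_congr _ (hev.mono fun z hz => christoffel_inr_inl_inr hz _ _ _), pd_zero]
  have e2 : ∀ s, pd (Sum.inl s) (christoffel (warpedMetric H w) (Sum.inl s) (Sum.inl 0)
      (Sum.inl 0)) x = 0 := fun s => by
    rw [pd_congr _ (hev.mono fun z hz => christoffel_inl_inl_inl hz _ _ _), pd_zero]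
  have e3 : ∀ k, pd (Sum.inr k) (christoffel (warpedMetric H w) (Sum.inr k) (Sum.inl 0)
      (Sum.inl 0)) x = w (spacePart x) * coordDeriv k (gradUp H w k) (spacePart x)
        + gradUp H w k (spacePart x) * coordDeriv k w (spacePart x) := fun k => by
    rw [pd_congr _ (hev.mono fun z hz => christoffel_inr_inl_inl hz _ _ _),
      pd_inr_comp_spacePart k (fun y => w y * gradUp H w k y),
      coordDeriv_mul k (h.contDiffAt_w.differentiableAt two_ne_zero)
        (differentiableAt_gradUp h h.contDiffAt_w k)]
  have hw := h.pos.ne'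
  rw [ricci]
  simp only [e1, Fintype.sum_sum_type, e2, e3, christoffel_inl_inl_inl h,
    christoffel_inl_inl_inr h, christoffel_inr_inl_inl h,
    christoffel_inr_inl_inr h, christoffel_inr_inr_inl h, christoffel_inr_inr_inr h]
  simp only [Finset.univ_unique, Finset.sum_singleton, laplacian, sub_zero, mul_zero,
    Finset.sum_const_zero, zero_add, mul_add, Finset.mul_sum, Finset.sum_mul,
    Finset.sum_add_distrib, Finset.sum_sub_distrib]
  rw [Finset.sum_comm (f := fun k l => w (spacePart x) *
    (spatialChristoffel H l l k (spacePart x) * gradUp H w k (spacePart x)))]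
  -- These normalise the |∇W|² terms, which cancel: one comes from differentiating Γ^k_00 and one
  -- from Γ^0_0k Γ^k_00, and the last product in the Ricci tensor subtracts two.
  have e4 : ∀ k, coordDeriv k w (spacePart x) / w (spacePart x)
      * (w (spacePart x) * gradUp H w k (spacePart x))
      = gradUp H w k (spacePart x) * coordDeriv k w (spacePart x) := fun k => by field_simp
  have e5 : ∀ k, w (spacePart x) * gradUp H w k (spacePart x)
      * (coordDeriv k w (spacePart x) / w (spacePart x))
      = gradUp H w k (spacePart x) * coordDeriv k w (spacePart x) := fun k => by field_simp
  have e6 : ∀ l k, spatialChristoffel H l l k (spacePart x)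
      * (w (spacePart x) * gradUp H w k (spacePart x))
      = w (spacePart x) * (spatialChristoffel H l l k (spacePart x)
        * gradUp H w k (spacePart x)) := fun l k => by ring
  simp only [e4, e5, e6]
  ring

section

variable (hr : IsRegularAt H w (spacePart x)) (s t : Fin 1) (i j k : Fin n)
include hr

omit hr in
lemma maxwellTensor_inl_inl :
    maxwellTensor (warpedMetric H w) (timelike f) x (Sum.inl s) (Sum.inl t) = 0 := by
  obtain rfl : s = t := Subsingleton.elim _ _
  simp [maxwellTensor]

lemma maxwellTensor_inl_inr :
    maxwellTensor (warpedMetric H w) (timelike f) x (Sum.inl s) (Sum.inr i)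
      = -coordDeriv i f (spacePart x) := by
  have h1 : pd (Sum.inr i) (fun y => timelike f y (Sum.inl s)) x = coordDeriv i f (spacePart x) :=
    pd_inr_comp_spacePart i f x
  have h2 : pd (Sum.inl s) (fun y => timelike f y (Sum.inr i)) x = 0 := pd_zero _ x
  simp only [maxwellTensor, covDerivCovector, h1, h2, Fintype.sum_sum_type,
    christoffel_inl_inl_inr hr, christoffel_inl_inr_inl hr, christoffel_inr_inl_inr hr,
    christoffel_inr_inr_inl hr]
  ring

lemma maxwellTensor_inr_inl :
    maxwellTensor (warpedMetric H w) (timelike f) x (Sum.inr i) (Sum.inl s)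
      = coordDeriv i f (spacePart x) := by
  have := maxwellTensor_inl_inr (f := f) hr s i
  rw [maxwellTensor] at this ⊢
  linarith

lemma maxwellTensor_inr_inr :
    maxwellTensor (warpedMetric H w) (timelike f) x (Sum.inr i) (Sum.inr j) = 0 := by
  simp [maxwellTensor, covDerivCovector, Fintype.sum_sum_type, christoffel_inl_inr_inr hr,
    timelike, pd_zero]

lemma maxwellTensorUp_inl_inl :
    maxwellTensorUp (warpedMetric H w) (timelike f) x (Sum.inl s) (Sum.inl t) = 0 := by
  simp [maxwellTensorUp, Fintype.sum_sum_type, maxwellTensor_inl_inl, invMetric_inl_inr hr]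

lemma maxwellTensorUp_inl_inr :
    maxwellTensorUp (warpedMetric H w) (timelike f) x (Sum.inl s) (Sum.inr i)
      = (w (spacePart x) ^ 2)⁻¹ * gradUp H f i (spacePart x) := by
  simp only [maxwellTensorUp, Fintype.sum_sum_type, maxwellTensor_inl_inl, invMetric_inl_inr hr,
    invMetric_inr_inl hr, invMetric_inl_inl hr, invMetric_inr_inr hr, maxwellTensor_inl_inr hr,
    gradUp]
  simp [Finset.mul_sum, mul_assoc]

lemma maxwellTensorUp_inr_inl :
    maxwellTensorUp (warpedMetric H w) (timelike f) x (Sum.inr i) (Sum.inl s)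
      = -((w (spacePart x) ^ 2)⁻¹ * gradUp H f i (spacePart x)) := by
  simp only [maxwellTensorUp, Fintype.sum_sum_type, maxwellTensor_inl_inl, invMetric_inl_inr hr,
    invMetric_inr_inl hr, invMetric_inl_inl hr, invMetric_inr_inr hr, maxwellTensor_inr_inl hr,
    gradUp]
  simp only [Finset.univ_unique, Finset.sum_singleton, zero_mul, Finset.sum_const_zero, zero_add,
    add_zero, Finset.mul_sum, mul_zero, ← Finset.sum_neg_distrib]
  exact Finset.sum_congr rfl fun a _ => by ring

lemma maxwellTensorUp_inr_inr :
    maxwellTensorUp (warpedMetric H w) (timelike f) x (Sum.inr i) (Sum.inr j) = 0 := by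
  simp [maxwellTensorUp, Fintype.sum_sum_type, maxwellTensor_inr_inr hr, invMetric_inr_inl hr]

/-- `F_{ρσ} F^{ρσ} = -2 W⁻² |∇φ|²`. -/
lemma maxwell_contraction :
    ∑ ρ, ∑ σ, maxwellTensor (warpedMetric H w) (timelike f) x ρ σ
      * maxwellTensorUp (warpedMetric H w) (timelike f) x ρ σ
      = -2 * (w (spacePart x) ^ 2)⁻¹ * gradInner H f f (spacePart x) := by
  simp only [Fintype.sum_sum_type, maxwellTensor_inl_inl, maxwellTensor_inl_inr hr,
    maxwellTensor_inr_inl hr, maxwellTensor_inr_inr hr, maxwellTensorUp_inl_inl hr,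
    maxwellTensorUp_inl_inr hr, maxwellTensorUp_inr_inl hr, maxwellTensorUp_inr_inr hr, gradInner]
  simp only [Finset.univ_unique, Finset.sum_singleton, mul_zero, Finset.sum_const_zero, zero_add,
    add_zero, Finset.mul_sum, ← Finset.sum_add_distrib]
  exact Finset.sum_congr rfl fun a _ => by ring

lemma maxwell_square_inl_inl :
    ∑ ρ, ∑ σ, invMetric (warpedMetric H w) x ρ σ
      * maxwellTensor (warpedMetric H w) (timelike f) x (Sum.inl s) σ
      * maxwellTensor (warpedMetric H w) (timelike f) x (Sum.inl t) ρ
      = gradInner H f f (spacePart x) := by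
  simp only [Fintype.sum_sum_type, maxwellTensor_inl_inl, maxwellTensor_inl_inr hr,
    invMetric_inr_inr hr, gradInner, gradUp]
  simp only [mul_zero, zero_mul, Finset.sum_const_zero, zero_add, Finset.mul_sum]
  exact Finset.sum_congr rfl fun a _ => Finset.sum_congr rfl fun b _ => by ring

lemma maxwell_square_inr_inr :
    ∑ ρ, ∑ σ, invMetric (warpedMetric H w) x ρ σ
      * maxwellTensor (warpedMetric H w) (timelike f) x (Sum.inr i) σ
      * maxwellTensor (warpedMetric H w) (timelike f) x (Sum.inr j) ρ
      = -(w (spacePart x) ^ 2)⁻¹ * coordDeriv i f (spacePart x) * coordDeriv j f (spacePart x) := by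
  simp [Fintype.sum_sum_type, maxwellTensor_inr_inl hr, maxwellTensor_inr_inr hr,
    invMetric_inl_inl hr]

lemma maxwell_square_trace :
    ∑ μ, ∑ ν, invMetric (warpedMetric H w) x μ ν *
      ∑ ρ, ∑ σ, invMetric (warpedMetric H w) x ρ σ
        * maxwellTensor (warpedMetric H w) (timelike f) x μ σ
        * maxwellTensor (warpedMetric H w) (timelike f) x ν ρ
      = -2 * (w (spacePart x) ^ 2)⁻¹ * gradInner H f f (spacePart x) := by
  rw [Fintype.sum_sum_type]
  simp only [Fintype.sum_sum_type (f := fun ν => invMetric (warpedMetric H w) x _ ν * _),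
    invMetric_inl_inr hr, invMetric_inr_inl hr, maxwell_square_inl_inl hr,
    maxwell_square_inr_inr hr, invMetric_inl_inl hr, invMetric_inr_inr hr]
  simp only [Finset.univ_unique, Finset.sum_singleton, zero_mul, Finset.sum_const_zero, zero_add,
    add_zero]
  have : ∑ i, ∑ j, (H (spacePart x))⁻¹ i j * (-(w (spacePart x) ^ 2)⁻¹
      * coordDeriv i f (spacePart x) * coordDeriv j f (spacePart x))
      = -(w (spacePart x) ^ 2)⁻¹ * gradInner H f f (spacePart x) := by
    simp only [gradInner, gradUp, Finset.mul_sum]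
    exact Finset.sum_congr rfl fun a _ => Finset.sum_congr rfl fun b _ => by ring
  rw [this]; ring

lemma metric_trace :
    ∑ μ, ∑ ν, invMetric (warpedMetric H w) x μ ν * warpedMetric H w x μ ν = n + 1 := by
  have hw := hr.pos.ne'
  have := sum_inv_mul_self hr.symm hr.isUnit_det
  simp only [Fintype.sum_sum_type, invMetric_inl_inl hr, invMetric_inl_inr hr,
    invMetric_inr_inl hr, invMetric_inr_inr hr]
  simp only [warpedMetric, Matrix.fromBlocks_apply₁₁, Matrix.fromBlocks_apply₂₂, this, zero_mul,
    Finset.sum_const_zero, add_zero, zero_add, Matrix.of_apply, Finset.univ_unique,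
    Finset.sum_singleton, Fintype.card_fin]
  field_simp
  ring

lemma maxwellStress_inl_inl (S : ℝ) :
    maxwellStress S (warpedMetric H w) (timelike f) x (Sum.inl 0) (Sum.inl 0)
      = (1 / S) * (gradInner H f f (spacePart x) / 2) := by
  have hw := hr.pos.ne'
  rw [maxwellStress, maxwell_square_inl_inl hr, maxwell_contraction hr]
  simp only [warpedMetric, Matrix.fromBlocks_apply₁₁, Matrix.of_apply]
  field_simp
  ring

/-- The trace is (1 - (n+1)/4) F_{ρσ}F^{ρσ}/S, since contracting the first term of the stress
reproduces F² and g has trace n + 1. It vanishes for n = 3, where Maxwell theory is conformally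
invariant. -/
lemma maxwellStress_trace (S : ℝ) :
    ∑ μ, ∑ ν, invMetric (warpedMetric H w) x μ ν *
      maxwellStress S (warpedMetric H w) (timelike f) x μ ν
      = (1 / S) * (((n : ℝ) - 3) / 2 * (w (spacePart x) ^ 2)⁻¹
          * gradInner H f f (spacePart x)) := by
  simp only [maxwellStress, maxwell_contraction hr]
  have : ∀ μ ν, invMetric (warpedMetric H w) x μ ν * (1 / S *
      ((∑ ρ, ∑ σ, invMetric (warpedMetric H w) x ρ σ
        * maxwellTensor (warpedMetric H w) (timelike f) x μ σ
        * maxwellTensor (warpedMetric H w) (timelike f) x ν ρ)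
        - 1 / 4 * warpedMetric H w x μ ν * (-2 * (w (spacePart x) ^ 2)⁻¹
          * gradInner H f f (spacePart x))))
      = 1 / S * (invMetric (warpedMetric H w) x μ ν *
        (∑ ρ, ∑ σ, invMetric (warpedMetric H w) x ρ σ
          * maxwellTensor (warpedMetric H w) (timelike f) x μ σ
          * maxwellTensor (warpedMetric H w) (timelike f) x ν ρ))
        - 1 / S * (1 / 4 * (-2 * (w (spacePart x) ^ 2)⁻¹
          * gradInner H f f (spacePart x)))
          * (invMetric (warpedMetric H w) x μ ν * warpedMetric H w x μ ν) :=
    fun μ ν => by ring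
  simp only [this, Finset.sum_sub_distrib, ← Finset.mul_sum]
  rw [maxwell_square_trace hr, metric_trace hr]
  ring

/-- The velocity is normalised by U_μ U^μ = -1, so the trace is -(ρ_m + p) + (n + 1)p. -/
lemma fluidStress_trace (ρm p : (Fin 1 ⊕ Fin n → ℝ) → ℝ) :
    ∑ μ, ∑ ν, invMetric (warpedMetric H w) x μ ν *
      fluidStress (warpedMetric H w) (timelike fun z => -w z) ρm p x μ ν
      = -ρm x + n * p x := by
  have hw := hr.pos.ne'
  have h1 : ∑ μ, ∑ ν, invMetric (warpedMetric H w) x μ ν *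
      (timelike (fun z => -w z) x μ * timelike (fun z => -w z) x ν) = -1 := by
    simp only [Fintype.sum_sum_type, invMetric_inl_inl hr, timelike, Sum.elim_inl, Sum.elim_inr]
    simp only [Finset.univ_unique, Finset.sum_singleton, mul_zero, zero_mul,
      Finset.sum_const_zero, add_zero]
    field_simp
  have : ∀ μ ν, invMetric (warpedMetric H w) x μ ν *
      fluidStress (warpedMetric H w) (timelike fun z => -w z) ρm p x μ ν
      = (ρm x + p x) * (invMetric (warpedMetric H w) x μ ν *
        (timelike (fun z => -w z) x μ * timelike (fun z => -w z) x ν))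
        + p x * (invMetric (warpedMetric H w) x μ ν * warpedMetric H w x μ ν) := fun μ ν => by
    rw [fluidStress]; ring
  simp only [this, Finset.sum_add_distrib, ← Finset.mul_sum]
  rw [h1, metric_trace hr]
  ring

end

/-- The time-time component of Einstein's equation, trace reversed. -/
lemma laplacian_warp (hn : 3 ≤ n) {S Gd : ℝ} (hS : S ≠ 0)
    {U : (Fin 1 ⊕ Fin n → ℝ) → Fin 1 ⊕ Fin n → ℝ}
    {ρm ρe p : (Fin 1 ⊕ Fin n → ℝ) → ℝ}
    (hU : U = timelike fun z => -w z)
    (hr : ∀ᶠ y in 𝓝 (spacePart x), IsRegularAt H w y)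
    (heq : EinsteinMaxwellAt (dim n) S Gd (warpedMetric H w) (timelike f) U ρm ρe p x) :
    w (spacePart x) * laplacian H w (spacePart x)
      = S * Gd * w (spacePart x) ^ 2 * (ρm x + (dim n - 1) / (dim n - 3) * p x)
        + Gd * gradInner H f f (spacePart x) := by
  subst hU
  have h := hr.self_of_nhds
  have hw := h.pos.ne'
  have hn' : (3 : ℝ) ≤ n := by exact_mod_cast hn
  have h00 := heq.1 (Sum.inl 0) (Sum.inl 0)
  have htr : ∑ μ, ∑ ν, invMetric (warpedMetric H w) x μ ν * einsteinTensor (warpedMetric H w) x μ ν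
      = ∑ μ, ∑ ν, invMetric (warpedMetric H w) x μ ν * ((dim n - 2) / (dim n - 3) * S * Gd *
        (fluidStress (warpedMetric H w) (timelike fun z => -w z) ρm p x μ ν
          + maxwellStress S (warpedMetric H w) (timelike f) x μ ν)) := by
    simp only [heq.1]
  have hl : ∀ μ ν, invMetric (warpedMetric H w) x μ ν * einsteinTensor (warpedMetric H w) x μ ν
      = invMetric (warpedMetric H w) x μ ν * ricci (warpedMetric H w) x μ ν
        - 1 / 2 * scalarCurvature (warpedMetric H w) x
          * (invMetric (warpedMetric H w) x μ ν * warpedMetric H w x μ ν) := fun μ ν => by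
    rw [einsteinTensor]; ring
  have hrt : ∀ μ ν, invMetric (warpedMetric H w) x μ ν * ((dim n - 2) / (dim n - 3) * S * Gd *
        (fluidStress (warpedMetric H w) (timelike fun z => -w z) ρm p x μ ν
          + maxwellStress S (warpedMetric H w) (timelike f) x μ ν))
      = (dim n - 2) / (dim n - 3) * S * Gd * (invMetric (warpedMetric H w) x μ ν *
          fluidStress (warpedMetric H w) (timelike fun z => -w z) ρm p x μ ν)
        + (dim n - 2) / (dim n - 3) * S * Gd * (invMetric (warpedMetric H w) x μ ν *
          maxwellStress S (warpedMetric H w) (timelike f) x μ ν) := fun μ ν => by ring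
  simp only [hl, hrt, Finset.sum_sub_distrib, Finset.sum_add_distrib, ← Finset.mul_sum] at htr
  rw [metric_trace h, fluidStress_trace h, maxwellStress_trace h, ← scalarCurvature] at htr
  rw [einsteinTensor, ricci_inl_inl hr, maxwellStress_inl_inl h, fluidStress] at h00
  simp only [warpedMetric, Matrix.fromBlocks_apply₁₁, Matrix.of_apply, timelike, Sum.elim_inl]
    at h00
  change _ - 1 / 2 * _ * scalarCurvature (warpedMetric H w) x = _ at h00
  simp only [dim] at htr h00 ⊢
  generalize scalarCurvature (warpedMetric H w) x = R at *
  generalize laplacian H w (spacePart x) = L at *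
  generalize gradInner H f f (spacePart x) = Q at *
  generalize w (spacePart x) = W at *
  generalize ρm x = r at *
  generalize p x = q at *
  generalize (n : ℝ) = N at *
  -- The traced equation reads R(1 - (n+1)/2) = trace of the source, and the coefficient is nonzero
  -- for n ≥ 3. Eliminating R from the 00 equation leaves WΔW alone.
  have hR : R = ((N + 1 - 2) / (N + 1 - 3) * S * Gd * (-r + N * q) +
      (N + 1 - 2) / (N + 1 - 3) * S * Gd * (1 / S * ((N - 3) / 2 * (W ^ 2)⁻¹ * Q)))
        / (1 - 1 / 2 * (N + 1)) := by
    rw [eq_div_iff (by linarith), ← htr]; ring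
  have h1 : N - 1 ≠ 0 := by linarith
  have h2 : N - 2 ≠ 0 := by linarith
  have h3 : 1 - 1 / 2 * (N + 1) = -(N - 1) / 2 := by ring
  have h4 : N + 1 - 2 = N - 1 := by ring
  have h5 : N + 1 - 3 = N - 2 := by ring
  rw [h3, h4, h5] at hR
  rw [h4, h5, hR] at h00
  rw [h5]
  rw [sub_eq_iff_eq_add] at h00
  rw [h00]
  field_simp
  ring

/-- The time component of Maxwell's equation. -/
lemma laplacian_potential {S Gd d : ℝ} {U : (Fin 1 ⊕ Fin n → ℝ) → Fin 1 ⊕ Fin n → ℝ}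
    {ρm ρe p : (Fin 1 ⊕ Fin n → ℝ) → ℝ}
    (hU : U = timelike fun z => -w z)
    (hr : ∀ᶠ y in 𝓝 (spacePart x), IsRegularAt H w y) (hf : ContDiffAt ℝ 2 f (spacePart x))
    (heq : EinsteinMaxwellAt d S Gd (warpedMetric H w) (timelike f) U ρm ρe p x) :
    laplacian H f (spacePart x) = gradInner H w f (spacePart x) / w (spacePart x)
      + S * ρe x * w (spacePart x) := by
  subst hU
  have hev := eventually_spacePart hr
  have h := hr.self_of_nhds
  have hw := h.pos.ne'
  have hwd := h.contDiffAt_w.differentiableAt two_ne_zero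
  have h0 := heq.2 (Sum.inl 0)
  have e1 : ∀ s, pd (Sum.inl s) (fun y => maxwellTensorUp (warpedMetric H w) (timelike f) y
      (Sum.inl 0) (Sum.inl s)) x = 0 := fun s => by
    rw [pd_congr _ (hev.mono fun z hz => maxwellTensorUp_inl_inl hz _ _), pd_zero]
  have e2 : ∀ k, pd (Sum.inr k) (fun y => maxwellTensorUp (warpedMetric H w) (timelike f) y
      (Sum.inl 0) (Sum.inr k)) x
      = (w (spacePart x) ^ 2)⁻¹ * coordDeriv k (gradUp H f k) (spacePart x)
        - 2 * (w (spacePart x) ^ 3)⁻¹ *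
          (coordDeriv k w (spacePart x) * gradUp H f k (spacePart x)) := fun k => by
    rw [pd_congr _ (hev.mono fun z hz => maxwellTensorUp_inl_inr hz _ _),
      pd_inr_comp_spacePart k (fun y => (w y ^ 2)⁻¹ * gradUp H f k y),
      coordDeriv_mul k ((hwd.fun_pow 2).fun_inv (pow_ne_zero 2 hw)) (differentiableAt_gradUp h hf k),
      coordDeriv_inv k (hwd.fun_pow 2) (pow_ne_zero 2 hw), coordDeriv_sq k hwd]
    field_simp
    ring
  -- Differentiating W⁻² contributes -2W⁻³⟨∂W, ∂f⟩ and Γ^0_0k F^{0k} contributes +1 times the same,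
  -- so a single drift term remains. The terms Γ^0_νσ F^{σν} cancel by antisymmetry of F.
  have e3 : ∀ k, coordDeriv k w (spacePart x) / w (spacePart x)
      * ((w (spacePart x) ^ 2)⁻¹ * gradUp H f k (spacePart x))
      = (w (spacePart x) ^ 3)⁻¹ *
        (coordDeriv k w (spacePart x) * gradUp H f k (spacePart x)) := fun k => by
    field_simp
  have e4 : ∀ l k, spatialChristoffel H l l k (spacePart x)
      * ((w (spacePart x) ^ 2)⁻¹ * gradUp H f k (spacePart x))
      = (w (spacePart x) ^ 2)⁻¹ *
        (spatialChristoffel H l l k (spacePart x) * gradUp H f k (spacePart x)) := fun l k => by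
    ring
  rw [divMaxwell, currentUp] at h0
  simp only [Fintype.sum_sum_type, e1, e2, christoffel_inl_inl_inl h, christoffel_inl_inl_inr h,
    christoffel_inl_inr_inl h, christoffel_inl_inr_inr h, christoffel_inr_inr_inl h,
    christoffel_inr_inr_inr h, maxwellTensorUp_inl_inl h, maxwellTensorUp_inl_inr h,
    maxwellTensorUp_inr_inl h, maxwellTensorUp_inr_inr h, invMetric_inl_inl h,
    invMetric_inl_inr h, timelike, Sum.elim_inl] at h0
  simp only [Finset.univ_unique, Finset.sum_singleton, mul_zero, zero_mul,
    Finset.sum_const_zero, zero_add, add_zero, mul_neg, e3, e4,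
    Finset.sum_add_distrib, Finset.sum_sub_distrib, ← Finset.mul_sum, Finset.sum_neg_distrib] at h0
  have hL : laplacian H f (spacePart x) = (∑ k, coordDeriv k (gradUp H f k) (spacePart x)) +
      ∑ l, ∑ k, spatialChristoffel H l l k (spacePart x) * gradUp H f k (spacePart x) := by
    rw [laplacian, Finset.sum_comm]
    simp only [Finset.sum_mul]
  rw [hL, gradInner]
  field_simp at h0 ⊢
  linarith

end FieldEquations

/-! ### Hopf's strong maximum principle in Euclidean space -/

section MaximumPrinciple

variable {n : ℕ} {A : EuclideanSpace ℝ (Fin n) → Matrix (Fin n) (Fin n) ℝ}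
  {β : Fin n → EuclideanSpace ℝ (Fin n) → ℝ} {f g : EuclideanSpace ℝ (Fin n) → ℝ}
  {y : EuclideanSpace ℝ (Fin n)}

/-- The operator `A^{kj} ∂_k ∂_j + β^j ∂_j`. -/
def ellipticOp (A : EuclideanSpace ℝ (Fin n) → Matrix (Fin n) (Fin n) ℝ)
    (β : Fin n → EuclideanSpace ℝ (Fin n) → ℝ) (f : EuclideanSpace ℝ (Fin n) → ℝ)
    (y : EuclideanSpace ℝ (Fin n)) : ℝ :=
  (∑ k, ∑ j, A y k j * coordDeriv k (coordDeriv j f) y) + ∑ j, β j y * coordDeriv j f y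

lemma eq_sum_single (b : EuclideanSpace ℝ (Fin n)) :
    b = ∑ j, b j • EuclideanSpace.single j (1 : ℝ) := by
  ext i
  simp [Finset.sum_apply, Pi.single_apply]

lemma fderiv_eq_sum_coordDeriv (f : EuclideanSpace ℝ (Fin n) → ℝ) (y b : EuclideanSpace ℝ (Fin n)) :
    fderiv ℝ f y b = ∑ j, b j * coordDeriv j f y := by
  conv_lhs => rw [eq_sum_single b]
  simp [map_sum, coordDeriv]

lemma eventually_coordDeriv_add_const_mul (hf : ContDiffAt ℝ 2 f y) (hg : ContDiffAt ℝ 2 g y)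
    (c : ℝ) (j : Fin n) : coordDeriv j (fun z => f z + c * g z) =ᶠ[𝓝 y]
      fun z => coordDeriv j f z + c * coordDeriv j g z := by
  filter_upwards [hf.eventually (by simp), hg.eventually (by simp)] with z hz hz'
  have h2 := hz'.differentiableAt two_ne_zero
  rw [coordDeriv_add j (hz.differentiableAt two_ne_zero) (h2.const_mul c),
    coordDeriv_mul j (differentiableAt_const c) h2, coordDeriv_const]
  ring

/-- This linearity serves twice: for adding a small multiple of the barrier, and for passing from a
solution to its negative. -/
lemma ellipticOp_add_const_mul (hf : ContDiffAt ℝ 2 f y) (hg : ContDiffAt ℝ 2 g y) (c : ℝ) :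
    ellipticOp A β (fun z => f z + c * g z) y = ellipticOp A β f y + c * ellipticOp A β g y := by
  have h1 := eventually_coordDeriv_add_const_mul hf hg c
  have hd : ∀ {u : EuclideanSpace ℝ (Fin n) → ℝ}, ContDiffAt ℝ 2 u y → ∀ j,
      DifferentiableAt ℝ (coordDeriv j u) y := fun hu j =>
    (contDiffAt_coordDeriv (m := 1) j hu (by norm_num)).differentiableAt one_ne_zero
  have h2 : ∀ k j, coordDeriv k (coordDeriv j fun z => f z + c * g z) y
      = coordDeriv k (coordDeriv j f) y + c * coordDeriv k (coordDeriv j g) y := fun k j => by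
    rw [coordDeriv_congr k (h1 j), coordDeriv_add k (hd hf j) ((hd hg j).const_mul c),
      coordDeriv_mul k (differentiableAt_const c) (hd hg j), coordDeriv_const]
    ring
  simp only [ellipticOp, h2, (h1 _).self_of_nhds, mul_add, Finset.sum_add_distrib, Finset.mul_sum]
  simp only [mul_left_comm c]
  ring

/-- The second derivative in a fixed direction is nonpositive at a local maximum. -/
lemma second_deriv_nonpos_of_isLocalMax (hf : ContDiffAt ℝ 2 f y) (hm : IsLocalMax f y)
    (b : EuclideanSpace ℝ (Fin n)) :
    ∑ k, ∑ j, b k * b j * coordDeriv k (coordDeriv j f) y ≤ 0 := by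
  set u : ℝ → ℝ := fun t => f (y + t • b) with hu
  have hl : ∀ t : ℝ, HasDerivAt (fun t : ℝ => y + t • b) b t := fun t => by
    simpa using ((hasDerivAt_id t).smul_const b).const_add y
  have hl0 : Tendsto (fun t : ℝ => y + t • b) (𝓝 0) (𝓝 y) := by
    simpa using (hl 0).continuousAt.tendsto
  have hd1 : deriv u =ᶠ[𝓝 0] fun t => ∑ j, b j * coordDeriv j f (y + t • b) := by
    filter_upwards [hl0.eventually (hf.eventually (by simp))] with t ht
    rw [← fderiv_eq_sum_coordDeriv]
    exact ((ht.differentiableAt two_ne_zero).hasFDerivAt.comp_hasDerivAt t (hl t)).deriv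
  have hd2 : deriv (deriv u) 0 = ∑ k, ∑ j, b k * b j * coordDeriv k (coordDeriv j f) y := by
    rw [hd1.deriv_eq]
    have h2 : ∀ j, HasDerivAt (fun t : ℝ => b j * coordDeriv j f (y + t • b))
        (b j * ∑ k, b k * coordDeriv k (coordDeriv j f) y) 0 := fun j => by
      have h3 : DifferentiableAt ℝ (coordDeriv j f) (y + (0 : ℝ) • b) := by
        simpa using (contDiffAt_coordDeriv (m := 1) j hf (by norm_num)).differentiableAt one_ne_zero
      have h4 := (h3.hasFDerivAt.comp_hasDerivAt 0 (hl 0)).const_mul (b j)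
      rw [fderiv_eq_sum_coordDeriv, zero_smul, add_zero] at h4
      exact h4
    rw [(HasDerivAt.fun_sum fun j _ => h2 j).deriv, Finset.sum_comm]
    simp only [Finset.mul_sum]
    exact Finset.sum_congr rfl fun j _ => Finset.sum_congr rfl fun k _ => by ring
  rw [← hd2]
  -- A positive second derivative would make 0 a local minimum too, so u would be locally constant
  -- and its second derivative would vanish.
  by_contra! hpos
  have hm0 : IsLocalMax u 0 := by
    have : ∀ᶠ t in 𝓝 (0 : ℝ), f (y + t • b) ≤ f y := hl0.eventually hm
    filter_upwards [this] with t ht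
    simpa [hu] using ht
  have hc : ContinuousAt u 0 :=
    ContinuousAt.comp (g := f) (by simpa using hf.continuousAt) (hl 0).continuousAt
  have hmin := isLocalMin_of_deriv_deriv_pos hpos hm0.deriv_eq_zero hc
  have hconst : u =ᶠ[𝓝 0] fun _ => u 0 := by
    filter_upwards [hm0, hmin] with t h1 h2 using le_antisymm h1 h2
  have h5 : deriv u =ᶠ[𝓝 0] fun _ => 0 := by
    filter_upwards [hconst.eventuallyEq_nhds] with t ht
    rw [ht.deriv_eq, deriv_const]
  rw [h5.deriv_eq, deriv_const] at hpos
  exact lt_irrefl _ hpos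

open scoped MatrixOrder in
-- Factoring A = BᵀB turns the second-order part into a sum of second derivatives along the rows of
-- B, each nonpositive; the gradient vanishes at the maximum.
lemma ellipticOp_nonpos_of_isLocalMax (hA : (A y).PosSemidef) (hf : ContDiffAt ℝ 2 f y)
    (hm : IsLocalMax f y) : ellipticOp A β f y ≤ 0 := by
  have h1 : ∀ j, coordDeriv j f y = 0 := fun j => by
    rw [coordDeriv, hm.fderiv_eq_zero]; rfl
  obtain ⟨B, hB⟩ := CStarAlgebra.nonneg_iff_eq_star_mul_self.mp hA.nonneg
  simp only [ellipticOp, h1, mul_zero, Finset.sum_const_zero, add_zero]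
  have h2 : ∑ k, ∑ j, A y k j * coordDeriv k (coordDeriv j f) y
      = ∑ l, ∑ k, ∑ j, B l k * B l j * coordDeriv k (coordDeriv j f) y := by
    symm
    rw [Finset.sum_comm]
    refine Finset.sum_congr rfl fun k _ => ?_
    rw [Finset.sum_comm]
    refine Finset.sum_congr rfl fun j _ => ?_
    rw [hB, Matrix.mul_apply, Finset.sum_mul]
    simp [Matrix.star_apply]
  rw [h2]
  refine Finset.sum_nonpos fun l _ => ?_
  exact second_deriv_nonpos_of_isLocalMax hf hm (WithLp.toLp 2 fun k => B l k)

/-- Hopf's barrier around the point `c`. -/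
def hopfBarrier (α R : ℝ) (c z : EuclideanSpace ℝ (Fin n)) : ℝ :=
  Real.exp (-α * ‖z - c‖ ^ 2) - Real.exp (-α * R ^ 2)

lemma contDiff_hopfBarrier (α R : ℝ) (c : EuclideanSpace ℝ (Fin n)) :
    ContDiff ℝ ∞ (hopfBarrier α R c) := by
  unfold hopfBarrier
  exact ((contDiff_const.mul ((contDiff_id.sub contDiff_const).norm_sq ℝ)).exp).sub contDiff_const

lemma coordDeriv_hopfBarrier (α R : ℝ) (c : EuclideanSpace ℝ (Fin n)) (j : Fin n) :
    coordDeriv j (hopfBarrier α R c)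
      = fun z => -2 * α * (z j - c j) * Real.exp (-α * ‖z - c‖ ^ 2) := by
  funext z
  have h1 : HasFDerivAt (fun z : EuclideanSpace ℝ (Fin n) => z - c) (.id ℝ _) z :=
    (hasFDerivAt_id z).sub_const c
  have h2 := (((h1.norm_sq).const_mul (-α)).exp).sub_const (Real.exp (-α * R ^ 2))
  rw [coordDeriv]
  change fderiv ℝ (fun z => Real.exp (-α * ‖z - c‖ ^ 2) - Real.exp (-α * R ^ 2)) z _ = _
  rw [h2.fderiv]
  simp [EuclideanSpace.inner_single_right]
  ring

lemma coordDeriv_coordDeriv_hopfBarrier (α R : ℝ) (c z : EuclideanSpace ℝ (Fin n)) (k j : Fin n) :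
    coordDeriv k (coordDeriv j (hopfBarrier α R c)) z
      = (4 * α ^ 2 * (z j - c j) * (z k - c k) - 2 * α * (if j = k then 1 else 0))
        * Real.exp (-α * ‖z - c‖ ^ 2) := by
  have hc : coordDeriv j (hopfBarrier α R c)
      = fun z => (-2 * α * (z j - c j)) * (hopfBarrier α R c z + Real.exp (-α * R ^ 2)) := by
    rw [coordDeriv_hopfBarrier]; funext z; simp [hopfBarrier]
  have h1 : HasFDerivAt (fun z : EuclideanSpace ℝ (Fin n) => -2 * α * (z j - c j))
      ((-2 * α) • EuclideanSpace.proj j) z :=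
    (((EuclideanSpace.proj j : EuclideanSpace ℝ (Fin n) →L[ℝ] ℝ).hasFDerivAt).sub_const
      (c j)).const_mul (-2 * α)
  have h2 : coordDeriv k (fun z : EuclideanSpace ℝ (Fin n) => -2 * α * (z j - c j)) z
      = -2 * α * (if j = k then 1 else 0) := by
    rw [coordDeriv, h1.fderiv]
    by_cases hjk : j = k <;> simp [hjk]
  have h3 := (contDiff_hopfBarrier α R c).differentiable (by simp) z
  rw [hc, coordDeriv_mul k h1.differentiableAt (h3.add_const _),
    coordDeriv_add k h3 (differentiableAt_const _), coordDeriv_const, h2, coordDeriv_hopfBarrier]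
  simp only [hopfBarrier]
  ring

/-- Apart from the positive exponential, the α² term carries the quadratic form of A at z - c and
all other terms are linear in α. Hence large α makes the barrier a strict subsolution away from c.
-/
lemma ellipticOp_hopfBarrier (α R : ℝ) (c z : EuclideanSpace ℝ (Fin n)) :
    ellipticOp A β (hopfBarrier α R c) z
      = 2 * α * (2 * α * (∑ k, ∑ j, A z k j * ((z j - c j) * (z k - c k)))
        - ((∑ k, A z k k) + ∑ j, β j z * (z j - c j))) * Real.exp (-α * ‖z - c‖ ^ 2) := by
  have h1 : ∀ k, ∑ j, A z k j * ((4 * α ^ 2 * (z j - c j) * (z k - c k)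
        - 2 * α * (if j = k then 1 else 0)) * Real.exp (-α * ‖z - c‖ ^ 2))
      = (4 * α ^ 2 * (∑ j, A z k j * ((z j - c j) * (z k - c k))) - 2 * α * A z k k)
        * Real.exp (-α * ‖z - c‖ ^ 2) := fun k => by
    have : A z k k = ∑ j, A z k j * (if j = k then 1 else 0) := by simp
    rw [this, Finset.mul_sum, Finset.mul_sum, ← Finset.sum_sub_distrib, Finset.sum_mul]
    exact Finset.sum_congr rfl fun j _ => by ring
  have h2 : ∑ j, β j z * (-2 * α * (z j - c j) * Real.exp (-α * ‖z - c‖ ^ 2))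
      = -2 * α * (∑ j, β j z * (z j - c j)) * Real.exp (-α * ‖z - c‖ ^ 2) := by
    rw [Finset.mul_sum, Finset.sum_mul]
    exact Finset.sum_congr rfl fun j _ => by ring
  simp only [ellipticOp, coordDeriv_coordDeriv_hopfBarrier, h1]
  simp only [coordDeriv_hopfBarrier, h2]
  rw [← Finset.sum_mul, Finset.sum_sub_distrib, ← Finset.mul_sum, ← Finset.mul_sum]
  ring

lemma exists_ellipticOp_hopfBarrier_pos (hA : (A y).PosDef) {c : EuclideanSpace ℝ (Fin n)}
    (hc : y ≠ c) (R : ℝ) : ∃ α > 0, 0 < ellipticOp A β (hopfBarrier α R c) y := by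
  set q := ∑ k, ∑ j, A y k j * ((y j - c j) * (y k - c k)) with hq
  have hqpos : 0 < q := by
    have hne : (fun i => y i - c i) ≠ 0 := fun h0 => hc (by
      ext i; simpa [sub_eq_zero] using congrFun h0 i)
    have := hA.dotProduct_mulVec_pos hne
    refine this.trans_eq ?_
    simp only [hq, dotProduct, Matrix.mulVec, star_trivial, Finset.mul_sum]
    exact Finset.sum_congr rfl fun k _ => Finset.sum_congr rfl fun j _ => by ring
  set T := (∑ k, A y k k) + ∑ j, β j y * (y j - c j) with hT
  -- With this α the bracket becomes 2(|T| + 1) - T, which is positive whatever the sign of T.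
  refine ⟨(|T| + 1) / q, by positivity, ?_⟩
  rw [ellipticOp_hopfBarrier, ← hq, ← hT]
  have h1 : 2 * ((|T| + 1) / q) * q = 2 * (|T| + 1) := by field_simp
  rw [h1]
  have : 0 < 2 * (|T| + 1) - T := by linarith [le_abs_self T, abs_nonneg T]
  positivity

lemma continuousAt_ellipticOp (hA : ∀ i j, ContinuousAt (fun z => A z i j) y)
    (hβ : ∀ j, ContinuousAt (β j) y) (hf : ContDiffAt ℝ 2 f y) :
    ContinuousAt (ellipticOp A β f) y := by
  unfold ellipticOp
  have h1 : ∀ j, ContDiffAt ℝ 1 (coordDeriv j f) y := fun j =>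
    contDiffAt_coordDeriv j hf (by norm_num)
  have h2 : ∀ k j, ContinuousAt (coordDeriv k (coordDeriv j f)) y := fun k j =>
    (contDiffAt_coordDeriv (m := 0) k (h1 j) (by norm_num)).continuousAt
  refine ContinuousAt.add ?_ ?_
  · exact tendsto_finsetSum _ fun k _ => tendsto_finsetSum _ fun j _ => (hA k j).mul (h2 k j)
  · exact tendsto_finsetSum _ fun j _ => (hβ j).mul (h1 j).continuousAt

/-- A solution of a homogeneous elliptic equation that is `< m` in a closed ball except at one
point of its boundary, and `≤ m` near that point, cannot equal `m` there. -/
lemma hopf_touching {V : Set (EuclideanSpace ℝ (Fin n))} {m R : ℝ}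
    {c x₁ : EuclideanSpace ℝ (Fin n)} (hV : V ∈ 𝓝 x₁)
    (hAc : ∀ i j, ContinuousAt (fun z => A z i j) x₁) (hβ : ∀ j, ContinuousAt (β j) x₁)
    (hA : ∀ z ∈ V, (A z).PosDef) (hf : ∀ z ∈ V, ContDiffAt ℝ 2 f z)
    (hP : ∀ z ∈ V, ellipticOp A β f z = 0) (hle : ∀ z ∈ V, f z ≤ m)
    (hR : 0 < R) (hx₁ : dist x₁ c = R)
    (hlt : ∀ z ∈ V, dist z c ≤ R → z ≠ x₁ → f z < m) : f x₁ ≠ m := by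
  intro hfx
  have hne : x₁ ≠ c := fun h => by rw [h, dist_self] at hx₁; exact hR.ne hx₁
  obtain ⟨α, hα, hpos⟩ := exists_ellipticOp_hopfBarrier_pos (A := A) (β := β)
    (hA _ (mem_of_mem_nhds hV)) hne R
  set v := hopfBarrier α R c with hv
  have hv2 : ∀ z, ContDiffAt ℝ 2 v z := fun z =>
    (contDiff_infty.1 (contDiff_hopfBarrier α R c) 2).contDiffAt
  have hvx : v x₁ = 0 := by simp [hv, hopfBarrier, ← dist_eq_norm, hx₁]
  have hv1 : ∀ z, v z ≤ 1 := fun z => by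
    have h1 : Real.exp (-α * ‖z - c‖ ^ 2) ≤ 1 := Real.exp_le_one_iff.2 (by
      nlinarith [sq_nonneg ‖z - c‖])
    have h2 := Real.exp_pos (-α * R ^ 2)
    simp only [hv, hopfBarrier]
    linarith
  have hvneg : ∀ z, R < dist z c → v z < 0 := fun z hz => by
    simp only [hv, hopfBarrier, sub_neg, Real.exp_lt_exp, ← dist_eq_norm]
    have : R ^ 2 < dist z c ^ 2 := pow_lt_pow_left₀ hz hR.le two_ne_zero
    nlinarith
  have hev : ∀ᶠ z in 𝓝 x₁, z ∈ V ∧ 0 < ellipticOp A β v z :=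
    Filter.Eventually.and hV ((continuousAt_ellipticOp hAc hβ (hv2 x₁)).eventually (lt_mem_nhds hpos))
  obtain ⟨s, hs, hball⟩ := Metric.nhds_basis_closedBall.eventually_iff.1 hev
  have hcont : ContinuousOn f (Metric.closedBall x₁ s) := fun z hz =>
    (hf z (hball hz).1).continuousAt.continuousWithinAt
  -- Outside the closed ball around c the barrier is negative and f ≤ m, so any δ > 0 works. On the
  -- compact remainder of the sphere f stays below m by a fixed gap, and v ≤ 1 lets half that gap
  -- serve as δ.
  obtain ⟨δ, hδ, hsph⟩ : ∃ δ > 0, ∀ z ∈ Metric.sphere x₁ s, f z + δ * v z < m := by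
    have hsub : Metric.sphere x₁ s ∩ Metric.closedBall c R ⊆ Metric.closedBall x₁ s :=
      fun z hz => Metric.sphere_subset_closedBall hz.1
    have hK : IsCompact (Metric.sphere x₁ s ∩ Metric.closedBall c R) :=
      (isCompact_sphere _ _).inter_right Metric.isClosed_closedBall
    have hout : ∀ δ > 0, ∀ z ∈ Metric.sphere x₁ s, z ∉ Metric.closedBall c R →
        f z + δ * v z < m := fun δ hδ z hz hz' => by
      have h1 := hle z (hball (Metric.sphere_subset_closedBall hz)).1
      have h2 := mul_neg_of_pos_of_neg hδ (hvneg z (by simpa using hz'))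
      linarith
    rcases (Metric.sphere x₁ s ∩ Metric.closedBall c R).eq_empty_or_nonempty with he | hne
    · refine ⟨1, one_pos, fun z hz => hout 1 one_pos z hz fun hz' => ?_⟩
      exact (Set.eq_empty_iff_forall_notMem.1 he z) ⟨hz, hz'⟩
    · obtain ⟨z₀, hz₀, hmax⟩ := hK.exists_isMaxOn hne (hcont.mono hsub)
      have h0 : f z₀ < m := hlt z₀ (hball (hsub hz₀)).1 hz₀.2 fun h => by
        have := hz₀.1
        rw [h, mem_sphere_iff_norm, sub_self, norm_zero] at this
        exact hs.ne this
      refine ⟨(m - f z₀) / 2, by linarith, fun z hz => ?_⟩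
      by_cases hz' : z ∈ Metric.closedBall c R
      · have h1 : f z ≤ f z₀ := hmax ⟨hz, hz'⟩
        nlinarith [hv1 z]
      · exact hout _ (by linarith) z hz hz'
  have hF : ∀ z ∈ V, ContDiffAt ℝ 2 (fun z => f z + δ * v z) z := fun z hz =>
    (hf z hz).add (contDiffAt_const.mul (hv2 z))
  obtain ⟨z₀, hz₀, hmax⟩ := (isCompact_closedBall x₁ s).exists_isMaxOn
    ⟨x₁, Metric.mem_closedBall_self hs.le⟩
    (f := fun z => f z + δ * v z)
    fun z hz => (hF z (hball hz).1).continuousAt.continuousWithinAt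
  -- The perturbed function equals m at x₁ but is below m on the sphere, so its maximum is interior;
  -- there the operator gives δ Lv > 0, contrary to the second-order condition.
  have h1 : m ≤ f z₀ + δ * v z₀ := by
    have := hmax (Metric.mem_closedBall_self hs.le : x₁ ∈ Metric.closedBall x₁ s)
    simpa [hfx, hvx] using this
  have hz₀' : z₀ ∈ Metric.ball x₁ s := by
    rcases (Metric.mem_closedBall.1 hz₀).lt_or_eq with h | h
    · exact h
    · exact absurd (hsph z₀ h) h1.not_gt
  have hloc : IsLocalMax (fun z => f z + δ * v z) z₀ :=
    hmax.isLocalMax (mem_of_superset (Metric.isOpen_ball.mem_nhds hz₀') Metric.ball_subset_closedBall)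
  obtain ⟨hzV, hzpos⟩ := hball hz₀
  have h2 := ellipticOp_nonpos_of_isLocalMax (β := β) (hA z₀ hzV).posSemidef (hF z₀ hzV) hloc
  rw [ellipticOp_add_const_mul (hf z₀ hzV) (hv2 z₀), hP z₀ hzV, zero_add] at h2
  exact absurd h2 (mul_pos hδ hzpos).not_ge

/-- The strong maximum principle: the set where a solution attains its maximum is open. -/
theorem eventually_eq_of_attains_max {V : Set (EuclideanSpace ℝ (Fin n))} (hV : IsOpen V) {m : ℝ}
    (hAc : ∀ z ∈ V, ∀ i j, ContinuousAt (fun z => A z i j) z)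
    (hβ : ∀ z ∈ V, ∀ j, ContinuousAt (β j) z)
    (hA : ∀ z ∈ V, (A z).PosDef) (hf : ∀ z ∈ V, ContDiffAt ℝ 2 f z)
    (hP : ∀ z ∈ V, ellipticOp A β f z = 0) (hle : ∀ z ∈ V, f z ≤ m)
    {x₀ : EuclideanSpace ℝ (Fin n)} (hx₀ : x₀ ∈ V) (hfx : f x₀ = m) : ∀ᶠ z in 𝓝 x₀, f z = m := by
  obtain ⟨r, hr, hball⟩ := Metric.nhds_basis_closedBall.mem_iff.1 (hV.mem_nhds hx₀)
  -- The half radius keeps the competition local: the point of K nearest to c is closer than r/2 to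
  -- c, so the ball around c reaching it stays in the closed r-ball.
  refine Metric.eventually_nhds_iff.2 ⟨r / 2, by linarith, fun c hc => ?_⟩
  by_contra hcm
  set K := Metric.closedBall x₀ r ∩ f ⁻¹' {m} with hKdef
  have hfc : ContinuousOn f (Metric.closedBall x₀ r) := fun z hz =>
    (hf z (hball hz)).continuousAt.continuousWithinAt
  have hK : IsCompact K := (isCompact_closedBall x₀ r).of_isClosed_subset
    (hfc.preimage_isClosed_of_isClosed Metric.isClosed_closedBall isClosed_singleton)
    Set.inter_subset_left
  have hx₀K : x₀ ∈ K := ⟨Metric.mem_closedBall_self hr.le, hfx⟩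
  obtain ⟨x₁, hx₁K, hmin⟩ := hK.exists_isMinOn ⟨x₀, hx₀K⟩
    (f := fun z => dist z c) (continuous_id.dist continuous_const).continuousOn
  have hR1 : dist x₁ c < r / 2 := lt_of_le_of_lt (hmin hx₀K) (by
    change dist x₀ c < _
    rwa [dist_comm])
  have hR : 0 < dist x₁ c := dist_pos.2 fun h => hcm (h ▸ hx₁K.2)
  -- The ball around c may touch K at several points. The ball with diameter from c to x₁ touches it
  -- only at x₁: this identity with dist z c ≥ dist x₁ c forces z = x₁.
  have hmid := fun z => EuclideanGeometry.dist_sq_add_dist_sq_eq_two_mul_dist_midpoint_sq_add_half_dist_sq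
    z x₁ c
  refine hopf_touching (m := m) (c := midpoint ℝ x₁ c) (R := dist x₁ c / 2)
    (hV.mem_nhds (hball hx₁K.1)) (hAc _ (hball hx₁K.1)) (hβ _ (hball hx₁K.1)) hA hf hP hle
    (by linarith) ?_ (fun z hz hzd hzne => ?_) hx₁K.2
  · rw [dist_left_midpoint]; simp; ring
  · refine (hle z hz).lt_of_ne fun hzm => hzne ?_
    have hzK : z ∈ K := by
      refine ⟨?_, hzm⟩
      have h1 : dist z x₀ ≤ dist z (midpoint ℝ x₁ c) + dist (midpoint ℝ x₁ c) c + dist c x₀ :=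
        (dist_triangle4 _ _ _ _)
      rw [dist_midpoint_right] at h1
      simp only [Real.norm_ofNat] at h1
      rw [Metric.mem_closedBall]
      linarith
    have h2 : dist x₁ c ≤ dist z c := hmin hzK
    have h3 := hmid z
    have h4 : dist z x₁ ^ 2 ≤ 0 := by
      have h5 : dist z (midpoint ℝ x₁ c) ^ 2 ≤ (dist x₁ c / 2) ^ 2 :=
        pow_le_pow_left₀ dist_nonneg hzd 2
      have h6 : dist x₁ c ^ 2 ≤ dist z c ^ 2 := pow_le_pow_left₀ dist_nonneg h2 2
      nlinarith
    exact dist_eq_zero.1 (pow_eq_zero_iff two_ne_zero |>.1 (le_antisymm h4 (sq_nonneg _)))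

end MaximumPrinciple

/-! ### The drift Laplacian of the quadratic defect -/

section QuadraticRelation

variable {n : ℕ} {H : EuclideanSpace ℝ (Fin n) → Matrix (Fin n) (Fin n) ℝ}
  {w u f : EuclideanSpace ℝ (Fin n) → ℝ} {x : Fin 1 ⊕ Fin n → ℝ} {y : EuclideanSpace ℝ (Fin n)}

/-- First-order coefficients of `f ↦ Δf - ⟨∂w, ∂f⟩ / w`. -/
def driftCoeff (H : EuclideanSpace ℝ (Fin n) → Matrix (Fin n) (Fin n) ℝ)
    (w : EuclideanSpace ℝ (Fin n) → ℝ) (j : Fin n) (y : EuclideanSpace ℝ (Fin n)) : ℝ :=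
  ∑ k, (coordDeriv k (fun z => (H z)⁻¹ k j) y
    + ((∑ l, spatialChristoffel H l l k y) - coordDeriv k w y / w y) * (H y)⁻¹ k j)

/-- Expanding the divergence by the product rule leaves no zeroth-order term, the form to which the
maximum principle applies. -/
lemma laplacian_sub_eq_ellipticOp (hr : IsRegularAt H w y) (hf : ContDiffAt ℝ 2 f y) :
    laplacian H f y - gradInner H w f y / w y
      = ellipticOp (fun z => (H z)⁻¹) (driftCoeff H w) f y := by
  have hi : ∀ k j, DifferentiableAt ℝ (fun z => (H z)⁻¹ k j) y := fun k j =>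
    (contDiffAt_matrix_inv hr.contDiffAt_H hr.isUnit_det k j).differentiableAt two_ne_zero
  have hd : ∀ j, DifferentiableAt ℝ (coordDeriv j f) y := fun j =>
    (contDiffAt_coordDeriv (m := 1) j hf (by norm_num)).differentiableAt one_ne_zero
  have h1 : ∀ k, coordDeriv k (gradUp H f k) y
      = ∑ j, ((H y)⁻¹ k j * coordDeriv k (coordDeriv j f) y
        + coordDeriv j f y * coordDeriv k (fun z => (H z)⁻¹ k j) y) := fun k => by
    change coordDeriv k (fun z => ∑ j, (H z)⁻¹ k j * coordDeriv j f z) y = _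
    rw [coordDeriv_sum _ k fun j _ => (hi k j).fun_mul (hd j)]
    exact Finset.sum_congr rfl fun j _ => coordDeriv_mul k (hi k j) (hd j)
  have h2 : ∑ j, driftCoeff H w j y * coordDeriv j f y
      = ∑ k, ∑ j, (coordDeriv k (fun z => (H z)⁻¹ k j) y
        + ((∑ l, spatialChristoffel H l l k y) - coordDeriv k w y / w y) * (H y)⁻¹ k j)
          * coordDeriv j f y := by
    simp only [driftCoeff, Finset.sum_mul (s := Finset.univ)]
    rw [Finset.sum_comm]
  rw [ellipticOp, h2, laplacian, gradInner, Finset.sum_div, add_sub_assoc,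
    ← Finset.sum_sub_distrib, ← Finset.sum_add_distrib, ← Finset.sum_add_distrib]
  refine Finset.sum_congr rfl fun k _ => ?_
  rw [h1, gradUp, Finset.mul_sum, Finset.mul_sum, Finset.sum_div, ← Finset.sum_sub_distrib,
    ← Finset.sum_add_distrib, ← Finset.sum_add_distrib]
  exact Finset.sum_congr rfl fun j _ => by ring

lemma continuousAt_driftCoeff (hr : IsRegularAt H w y) (j : Fin n) :
    ContinuousAt (driftCoeff H w j) y := by
  have hc : ∀ {g : EuclideanSpace ℝ (Fin n) → ℝ}, ContDiffAt ℝ 2 g y → ∀ i,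
      ContinuousAt (coordDeriv i g) y := fun hg i =>
    (contDiffAt_coordDeriv (m := 1) i hg (by norm_num)).continuousAt
  have hi := contDiffAt_matrix_inv hr.contDiffAt_H hr.isUnit_det
  have hΓ : ∀ l k, ContinuousAt (spatialChristoffel H l l k) y := fun l k => by
    unfold spatialChristoffel
    exact continuousAt_const.mul (tendsto_finsetSum _ fun s _ => (hi l s).continuousAt.mul
      (((hc (hr.contDiffAt_H k s) l).add (hc (hr.contDiffAt_H l s) k)).sub
        (hc (hr.contDiffAt_H l k) s)))
  unfold driftCoeff
  exact tendsto_finsetSum _ fun k _ => (hc (hi k j) k).add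
    (((tendsto_finsetSum _ fun l _ => hΓ l k).sub
      ((hc hr.contDiffAt_w k).div hr.contDiffAt_w.continuousAt hr.pos.ne')).mul
        (hi k j).continuousAt)

section

variable (a b c σ : ℝ)

/-- In the application σ = ε√G_d and u = -φ, the sign coming from the gauge field A_0 = -φ. -/
lemma coordDeriv_quadratic (hw : DifferentiableAt ℝ w y) (hu : DifferentiableAt ℝ u y)
    (j : Fin n) :
    coordDeriv j (fun z => w z ^ 2 - a * (σ * u z + b) ^ 2 - c) y
      = 2 * w y * coordDeriv j w y - 2 * a * σ * (σ * u y + b) * coordDeriv j u y := by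
  have h1 : DifferentiableAt ℝ (fun z => σ * u z) y := hu.const_mul σ
  have h2 : DifferentiableAt ℝ (fun z => σ * u z + b) y := h1.add_const b
  rw [coordDeriv_sub j ((hw.fun_pow 2).fun_sub ((h2.fun_pow 2).const_mul a))
    (differentiableAt_const c),
    coordDeriv_sub j (hw.fun_pow 2) ((h2.fun_pow 2).const_mul a), coordDeriv_sq j hw,
    coordDeriv_mul j (differentiableAt_const a) (h2.fun_pow 2), coordDeriv_sq j h2,
    coordDeriv_add j h1 (differentiableAt_const b), coordDeriv_mul j (differentiableAt_const σ) hu]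
  simp only [coordDeriv_const]
  ring

lemma gradUp_quadratic (hw : DifferentiableAt ℝ w y) (hu : DifferentiableAt ℝ u y) (k : Fin n) :
    gradUp H (fun z => w z ^ 2 - a * (σ * u z + b) ^ 2 - c) k y
      = 2 * w y * gradUp H w k y - 2 * a * σ * (σ * u y + b) * gradUp H u k y := by
  simp only [gradUp, coordDeriv_quadratic a b c σ hw hu, Finset.mul_sum,
    ← Finset.sum_sub_distrib]
  exact Finset.sum_congr rfl fun j _ => by ring

lemma gradInner_quadratic (hw : DifferentiableAt ℝ w y) (hu : DifferentiableAt ℝ u y) :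
    gradInner H w (fun z => w z ^ 2 - a * (σ * u z + b) ^ 2 - c) y
      = 2 * w y * gradInner H w w y - 2 * a * σ * (σ * u y + b) * gradInner H w u y := by
  simp only [gradInner, gradUp_quadratic a b c σ hw hu, Finset.mul_sum, ← Finset.sum_sub_distrib]
  exact Finset.sum_congr rfl fun j _ => by ring

lemma laplacian_quadratic (hr : IsRegularAt H w y) (hu : ContDiffAt ℝ 2 u y) :
    laplacian H (fun z => w z ^ 2 - a * (σ * u z + b) ^ 2 - c) y
      = 2 * w y * laplacian H w y + 2 * gradInner H w w y
        - 2 * a * σ * (σ * u y + b) * laplacian H u y - 2 * a * σ ^ 2 * gradInner H u u y := by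
  have hw1 := hr.contDiffAt_w.differentiableAt two_ne_zero
  have hu1 := hu.differentiableAt two_ne_zero
  have hψ : DifferentiableAt ℝ (fun z => σ * u z + b) y := (hu1.const_mul σ).add_const b
  have h1 : ∀ k, coordDeriv k (gradUp H (fun z => w z ^ 2 - a * (σ * u z + b) ^ 2 - c) k) y
      = 2 * w y * coordDeriv k (gradUp H w k) y + 2 * (coordDeriv k w y * gradUp H w k y)
        - 2 * a * σ * (σ * u y + b) * coordDeriv k (gradUp H u k) y
        - 2 * a * σ ^ 2 * (coordDeriv k u y * gradUp H u k y) := fun k => by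
    have he : gradUp H (fun z => w z ^ 2 - a * (σ * u z + b) ^ 2 - c) k =ᶠ[𝓝 y]
        fun z => 2 * w z * gradUp H w k z
          - 2 * a * σ * (σ * u z + b) * gradUp H u k z := by
      filter_upwards [hr.contDiffAt_w.eventually (by simp), hu.eventually (by simp)] with z hz hz'
      exact gradUp_quadratic a b c σ (hz.differentiableAt two_ne_zero)
        (hz'.differentiableAt two_ne_zero) k
    have hX := differentiableAt_gradUp hr hr.contDiffAt_w k
    have hY := differentiableAt_gradUp hr hu k
    have h2w := hw1.const_mul 2
    have hψ2 := hψ.const_mul (2 * a * σ)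
    rw [coordDeriv_congr k he, coordDeriv_sub k (h2w.fun_mul hX) (hψ2.fun_mul hY),
      coordDeriv_mul k h2w hX, coordDeriv_mul k hψ2 hY,
      coordDeriv_mul k (differentiableAt_const 2) hw1,
      coordDeriv_mul k (differentiableAt_const _) hψ,
      coordDeriv_add k (hu1.const_mul σ) (differentiableAt_const b),
      coordDeriv_mul k (differentiableAt_const σ) hu1]
    simp only [coordDeriv_const]
    ring
  simp only [laplacian, h1, gradUp_quadratic a b c σ hw1 hu1, gradInner]
  simp only [Finset.sum_sub_distrib, Finset.sum_add_distrib, ← Finset.mul_sum, mul_sub,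
    mul_left_comm (∑ l, spatialChristoffel H l l _ y)]
  ring

/-- For a static charged perfect fluid, `Δf - ⟨∂W, ∂f⟩ / W` with `f = W² - a (σ u + b)² - c` is a
multiple of the defect in the relation between the sources. -/
lemma laplacian_sub_quadratic (hn : 3 ≤ n) {S Gd : ℝ} (hS : S ≠ 0) (hσ : σ ^ 2 = Gd)
    {ρm ρe p : (Fin 1 ⊕ Fin n → ℝ) → ℝ}
    (hr : ∀ᶠ y in 𝓝 (spacePart x), IsRegularAt H w y) (hu : ContDiffAt ℝ 2 u (spacePart x))
    (heq : EinsteinMaxwellAt (dim n) S Gd (warpedMetric H w) (timelike u)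
      (timelike fun z => -w z) ρm ρe p x) :
    laplacian H (fun z => w z ^ 2 - a * (σ * u z + b) ^ 2 - c) (spacePart x)
        - gradInner H w (fun z => w z ^ 2 - a * (σ * u z + b) ^ 2 - c) (spacePart x)
          / w (spacePart x)
      = 2 * S * w (spacePart x) * σ *
        (σ * (ρm x + (dim n - 1) / (dim n - 3) * p x
          + (1 - a) * (1 / S * (gradInner H u u (spacePart x) / w (spacePart x) ^ 2)))
            * w (spacePart x)
          - a * ρe x * (σ * u (spacePart x) + b)) := by
  have h := hr.self_of_nhds
  have hw := h.pos.ne'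
  have h1 := laplacian_warp hn hS rfl hr heq
  have h2 := laplacian_potential rfl hr hu heq
  have hw1 := h.contDiffAt_w.differentiableAt two_ne_zero
  have hu1 := hu.differentiableAt two_ne_zero
  -- The drift cancels 2|∇W|² against the Laplacian of W², and its cross term cancels the one
  -- produced by Maxwell's equation. What is left contains only the sources and (1 - a)|∇u|².
  rw [laplacian_quadratic a b c σ h hu, gradInner_quadratic a b c σ hw1 hu1, mul_assoc 2, h1, h2,
    ← hσ]
  generalize (dim n - 1) / (dim n - 3) = κ
  field_simp
  ring

end

end QuadraticRelation

/-! ### Gradients in a frame -/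

section GramMatrix

variable {n : ℕ} (B : EuclideanSpace ℝ (Fin n) →L[ℝ] EuclideanSpace ℝ (Fin n) →L[ℝ] ℝ)
  (D : EuclideanSpace ℝ (Fin n) →L[ℝ] EuclideanSpace ℝ (Fin n))

/-- The matrix of a bilinear form in the frame `D e_i`. -/
def gram : Matrix (Fin n) (Fin n) ℝ :=
  Matrix.of fun i j => B (D (EuclideanSpace.single i 1)) (D (EuclideanSpace.single j 1))

lemma apply_frame_left (l : EuclideanSpace ℝ (Fin n) →L[ℝ] ℝ) (v : EuclideanSpace ℝ (Fin n)) :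
    l (D v) = ∑ i, v i * l (D (EuclideanSpace.single i 1)) := by
  conv_lhs => rw [eq_sum_single v]
  simp [map_sum]

variable {B D}

lemma gram_posDef (hs : ∀ v v', B v v' = B v' v) (hp : ∀ v, v ≠ 0 → 0 < B v v)
    (hD : Function.Injective D) : (gram B D).PosDef := by
  refine Matrix.PosDef.of_dotProduct_mulVec_pos ?_ fun x hx => ?_
  · ext i j
    simp [gram, Matrix.conjTranspose_apply, hs]
  · set v : EuclideanSpace ℝ (Fin n) := WithLp.toLp 2 x with hv
    have hv0 : D v ≠ 0 := fun h0 => hx (by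
      have : v = 0 := hD (by rw [h0, map_zero])
      funext i
      simpa using congrArg (fun z : EuclideanSpace ℝ (Fin n) => z i) this)
    refine (hp _ hv0).trans_eq ?_
    rw [hs, apply_frame_left D (B (D v)) v]
    simp only [dotProduct, Matrix.mulVec, star_trivial]
    refine Finset.sum_congr rfl fun i _ => ?_
    rw [hs, apply_frame_left D (B (D (EuclideanSpace.single i 1))) v]
    congr 1
    exact Finset.sum_congr rfl fun j _ => by simp [gram, hv, mul_comm]

/-- `ContinuousLinearMap.inverse` is 0 on non-invertible maps. Positivity makes B injective and
equality of dimensions makes it an isomorphism, so this default never occurs. -/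
lemma apply_inverse (hp : ∀ v, v ≠ 0 → 0 < B v v) (l : EuclideanSpace ℝ (Fin n) →L[ℝ] ℝ) :
    B (B.inverse l) = l := by
  have hinj : Function.Injective (B : EuclideanSpace ℝ (Fin n) →ₗ[ℝ]
      (EuclideanSpace ℝ (Fin n) →L[ℝ] ℝ)) := by
    rw [injective_iff_map_eq_zero]
    intro v hv
    by_contra h0
    have h1 := hp v h0
    have h2 : B v = 0 := hv
    rw [h2] at h1
    exact lt_irrefl _ h1
  have hfr : Module.finrank ℝ (EuclideanSpace ℝ (Fin n))
      = Module.finrank ℝ (EuclideanSpace ℝ (Fin n) →L[ℝ] ℝ) := by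
    rw [← (LinearMap.toContinuousLinearMap (𝕜 := ℝ) (E := EuclideanSpace ℝ (Fin n))
      (F' := ℝ)).finrank_eq, Module.finrank_linearMap, Module.finrank_self, mul_one]
  let e := (LinearEquiv.ofInjectiveOfFinrankEq (B : EuclideanSpace ℝ (Fin n) →ₗ[ℝ]
    (EuclideanSpace ℝ (Fin n) →L[ℝ] ℝ)) hinj hfr).toContinuousLinearEquiv
  have he : (e : EuclideanSpace ℝ (Fin n) →L[ℝ] _) = B := by
    ext v v'; rfl
  rw [← he, ContinuousLinearMap.inverse_equiv]
  simp

/-- If the gradient is Dξ and G is the Gram matrix, then l has frame components Gξ and both sides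
equal ξᵀGξ. This identifies the invariant |∇φ|² in `rhoEM` with the coordinate `gradInner`. -/
lemma gram_gradient (hs : ∀ v v', B v v' = B v' v) (hp : ∀ v, v ≠ 0 → 0 < B v v)
    (hD : Function.Bijective D) (l : EuclideanSpace ℝ (Fin n) →L[ℝ] ℝ) :
    B (B.inverse l) (B.inverse l) = ∑ k, l (D (EuclideanSpace.single k 1)) *
      ∑ j, (gram B D)⁻¹ k j * l (D (EuclideanSpace.single j 1)) := by
  obtain ⟨ξ, hξ⟩ := hD.2 (B.inverse l)
  have hpd := gram_posDef hs hp hD.1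
  have hl : ∀ j, l (D (EuclideanSpace.single j 1)) = (gram B D).mulVec ξ j := fun j => by
    conv_lhs => rw [← apply_inverse hp l, ← hξ, hs, apply_frame_left]
    simp only [Matrix.mulVec, dotProduct, gram, Matrix.of_apply]
    exact Finset.sum_congr rfl fun i _ => mul_comm _ _
  have hk : ∀ k, ∑ j, (gram B D)⁻¹ k j * l (D (EuclideanSpace.single j 1)) = ξ k := fun k => by
    simp only [hl]
    change ((gram B D)⁻¹.mulVec ((gram B D).mulVec ξ)) k = ξ k
    rw [Matrix.mulVec_mulVec, Matrix.nonsing_inv_mul _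
      ((Matrix.isUnit_iff_isUnit_det _).1 hpd.isUnit), Matrix.one_mulVec]
  rw [apply_inverse hp]
  conv_lhs => rw [← hξ, apply_frame_left]
  exact Finset.sum_congr rfl fun k _ => by rw [hk, mul_comm]

end GramMatrix

/-! ### From local constancy to a global sign -/

/-- On a connected space, a function on the closure of a proper relatively compact open set that
vanishes on the boundary and is locally constant where it attains its interior maximum is
nonpositive. -/
lemma nonpos_of_eventually_eq_at_max {X : Type*} [TopologicalSpace X] [ConnectedSpace X]
    {Ω : Set X} (hΩ : IsOpen Ω) (hc : IsCompact (closure Ω)) (hfr : (frontier Ω).Nonempty)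
    {F : X → ℝ} (hF : ContinuousOn F (closure Ω)) (h0 : ∀ q ∈ frontier Ω, F q = 0)
    (hmax : ∀ q ∈ Ω, (∀ q' ∈ Ω, F q' ≤ F q) → ∀ᶠ q' in 𝓝 q, F q' = F q) :
    ∀ q ∈ Ω, F q ≤ 0 := by
  intro q₀ hq₀
  by_contra! hpos
  obtain ⟨q₁, hq₁, hm⟩ := hc.exists_isMaxOn ⟨q₀, subset_closure hq₀⟩ hF
  have hq₁pos : 0 < F q₁ := hpos.trans_le (hm (subset_closure hq₀))
  set K := closure Ω ∩ F ⁻¹' {F q₁} with hK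
  have hKΩ : K ⊆ Ω := fun q hq => by
    by_contra hn
    have h1 := h0 q (by rw [hΩ.frontier_eq]; exact ⟨hq.1, hn⟩)
    have h2 : F q = F q₁ := hq.2
    linarith
  have hclosed : IsClosed K :=
    hF.preimage_isClosed_of_isClosed isClosed_closure isClosed_singleton
  have hopen : IsOpen K := isOpen_iff_mem_nhds.2 fun q hq => by
    have hqm : F q = F q₁ := hq.2
    have h1 := hmax q (hKΩ hq) fun q' hq' => hqm ▸ hm (subset_closure hq')
    filter_upwards [h1, hΩ.mem_nhds (hKΩ hq)] with q' h2 h3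
    exact ⟨subset_closure h3, h2.trans hqm⟩
  -- Connectedness of the whole space, not of Ω, is what is used: the level set would fill the space
  -- and hence contain a boundary point.
  have huniv : K = Set.univ := IsClopen.eq_univ ⟨hclosed, hopen⟩ ⟨q₁, hq₁, rfl⟩
  obtain ⟨z, hz⟩ := hfr
  have hzK : z ∈ K := huniv ▸ Set.mem_univ z
  rw [hΩ.frontier_eq] at hz
  exact hz.2 (hKΩ hzK)

lemma sphereArea_pos {n : ℕ} (hn : 3 ≤ n) : 0 < sphereArea n := by
  have hn' : (3 : ℝ) ≤ n := by exact_mod_cast hn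
  have h1 : 0 < (dim n - 1) / 2 := by simp only [dim]; linarith
  have := Real.Gamma_pos_of_pos h1
  have := Real.rpow_pos_of_pos Real.pi_pos ((dim n - 1) / 2)
  unfold sphereArea
  positivity

/-! ### Transfer to charts of the manifold -/

section Charts

variable {n : ℕ} {M : Type*} [TopologicalSpace M] [ChartedSpace (EuclideanSpace ℝ (Fin n)) M]
  [IsManifold (𝓡 n) ∞ M] {h : Bundle.RiemannianMetric (fun q : M => TangentSpace (𝓡 n) q)}
  {e : OpenPartialHomeomorph M (EuclideanSpace ℝ (Fin n))} {y : EuclideanSpace ℝ (Fin n)}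
  {U : Set M} {W φ ρm ρe p : M → ℝ} {Gd : ℝ}

lemma mfderiv_symm_bijective (he : e ∈ atlas (EuclideanSpace ℝ (Fin n)) M) (hy : y ∈ e.target) :
    Function.Bijective (mfderiv (𝓡 n) (𝓡 n) e.symm y) := by
  have : IsManifold (𝓡 n) 1 M := IsManifold.of_le (n := ∞) (by simp)
  exact (mdifferentiable_of_mem_atlas (I := 𝓡 n) he).symm.mfderiv_bijective hy

lemma contMDiffAt_symm (he : e ∈ atlas (EuclideanSpace ℝ (Fin n)) M) (hy : y ∈ e.target) :
    ContMDiffAt (𝓡 n) (𝓡 n) ∞ e.symm y :=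
  (contMDiffOn_symm_of_mem_maximalAtlas
    (IsManifold.subset_maximalAtlas he)).contMDiffAt (e.open_target.mem_nhds hy)

lemma contDiffAt_comp_symm (he : e ∈ atlas (EuclideanSpace ℝ (Fin n)) M) (hy : y ∈ e.target)
    (hU : IsOpen U) (hyU : e.symm y ∈ U) {f : M → ℝ}
    (hf : ContMDiffOn (𝓡 n) 𝓘(ℝ, ℝ) 2 f U) : ContDiffAt ℝ 2 (fun z => f (e.symm z)) y := by
  have h1 : ContMDiffAt (𝓡 n) (𝓡 n) 2 e.symm y :=
    (contMDiffAt_symm he hy).of_le (ENat.LEInfty.out)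
  exact contMDiffAt_iff_contDiffAt.1
    (ContMDiffAt.comp y (hf.contMDiffAt (hU.mem_nhds hyU)) h1)

lemma coordDeriv_comp_symm (he : e ∈ atlas (EuclideanSpace ℝ (Fin n)) M) (hy : y ∈ e.target)
    (hU : IsOpen U) (hyU : e.symm y ∈ U) {f : M → ℝ}
    (hf : ContMDiffOn (𝓡 n) 𝓘(ℝ, ℝ) 2 f U) (i : Fin n) :
    coordDeriv i (fun z => f (e.symm z)) y
      = mfderiv (𝓡 n) 𝓘(ℝ, ℝ) f (e.symm y)
        (mfderiv (𝓡 n) (𝓡 n) e.symm y (EuclideanSpace.single i (1 : ℝ))) := by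
  have h1 : MDifferentiableAt (𝓡 n) (𝓡 n) e.symm y :=
    (contMDiffAt_symm he hy).mdifferentiableAt (by simp)
  have h2 : MDifferentiableAt (𝓡 n) 𝓘(ℝ, ℝ) f (e.symm y) :=
    (hf.contMDiffAt (hU.mem_nhds hyU)).mdifferentiableAt two_ne_zero
  have h3 := mfderiv_comp y h2 h1
  rw [mfderiv_eq_fderiv] at h3
  change fderiv ℝ (f ∘ e.symm) y _ = _
  rw [h3]
  rfl

lemma isRegularAt_metricInChart (he : e ∈ atlas (EuclideanSpace ℝ (Fin n)) M)
    (hy : y ∈ e.target) (hU : IsOpen U) (hyU : e.symm y ∈ U)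
    (hs : IsStaticChargedFluid Gd h W φ ρm ρe p U) :
    IsRegularAt (metricInChart h e) (fun z => W (e.symm z)) y where
  pos := hs.pos _ hyU
  contDiffAt_w := contDiffAt_comp_symm he hy hU hyU hs.contMDiffOn_W
  contDiffAt_H i j := (hs.contDiffOn_h e he i j).contDiffAt
    ((e.symm.isOpen_inter_preimage hU).mem_nhds ⟨hy, hyU⟩)
  posDef := gram_posDef (B := h.inner (e.symm y)) (D := mfderiv (𝓡 n) (𝓡 n) e.symm y)
    (h.symm _) (h.pos _) (mfderiv_symm_bijective he hy).1

lemma inner_spatialGradient (he : e ∈ atlas (EuclideanSpace ℝ (Fin n)) M)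
    (hy : y ∈ e.target) (hU : IsOpen U) (hyU : e.symm y ∈ U)
    (hφ : ContMDiffOn (𝓡 n) 𝓘(ℝ, ℝ) 2 φ U) :
    h.inner (e.symm y) (spatialGradient h φ (e.symm y)) (spatialGradient h φ (e.symm y))
      = gradInner (metricInChart h e) (fun z => φ (e.symm z)) (fun z => φ (e.symm z)) y := by
  simp only [gradInner, gradUp, coordDeriv_comp_symm he hy hU hyU hφ]
  exact gram_gradient (B := h.inner (e.symm y)) (D := mfderiv (𝓡 n) (𝓡 n) e.symm y)
    (h.symm _) (h.pos _) (mfderiv_symm_bijective he hy) (mfderiv (𝓡 n) 𝓘(ℝ, ℝ) φ (e.symm y))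

lemma gradInner_neg (H : EuclideanSpace ℝ (Fin n) → Matrix (Fin n) (Fin n) ℝ)
    (f : EuclideanSpace ℝ (Fin n) → ℝ) :
    gradInner H (fun z => -f z) (fun z => -f z) y = gradInner H f f y := by
  simp [gradInner, gradUp, coordDeriv_neg]

/-- The function `W² - a (-ε √G φ + b)² - c`. -/
def relationDefect (Gd ε a b c : ℝ) (W φ : M → ℝ) (q : M) : ℝ :=
  W q ^ 2 - a * (-ε * √Gd * φ q + b) ^ 2 - c

/-- In a chart, the drift Laplacian of `W² - a (-ε √G φ + b)² - c` is a multiple of the defect in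
the relation between the sources. -/
lemma ellipticOp_relationDefect (hn : 3 ≤ n) (ε a b c : ℝ) (hGd : 0 < Gd) (hε : ε = 1 ∨ ε = -1)
    (he : e ∈ atlas (EuclideanSpace ℝ (Fin n)) M)
    (hy : y ∈ e.target) (hU : IsOpen U) (hyU : e.symm y ∈ U)
    (hs : IsStaticChargedFluid Gd h W φ ρm ρe p U) :
    ellipticOp (fun z => (metricInChart h e z)⁻¹)
        (driftCoeff (metricInChart h e) fun z => W (e.symm z))
        (fun z => relationDefect Gd ε a b c W φ (e.symm z)) y
      = 2 * sphereArea n * W (e.symm y) * (ε * √Gd) *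
        (ε * √Gd * (ρm (e.symm y) + (dim n - 1) / (dim n - 3) * p (e.symm y)
          + (1 - a) * rhoEM h W φ (e.symm y)) * W (e.symm y)
          - a * ρe (e.symm y) * (-ε * √Gd * φ (e.symm y) + b)) := by
  have hσ : (ε * √Gd) ^ 2 = Gd := by
    rw [mul_pow, Real.sq_sqrt hGd.le]
    rcases hε with rfl | rfl <;> norm_num
  have hreg : ∀ᶠ z in 𝓝 y, IsRegularAt (metricInChart h e) (fun z => W (e.symm z)) z := by
    filter_upwards [(e.symm.isOpen_inter_preimage hU).mem_nhds ⟨hy, hyU⟩] with z hz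
    exact isRegularAt_metricInChart he hz.1 hU hz.2 hs
  have hφ := contDiffAt_comp_symm he hy hU hyU hs.contMDiffOn_φ
  have hx := spacePart_sliceL y
  have heq := hs.equations e he (sliceL n y) (by rwa [hx]) (by rwa [hx])
  -- The equations are evaluated on the slice t = 0. There `staticMetric` and `timeCovector` agree
  -- by definition with `warpedMetric` and `timelike` of the fields pulled back by the chart.
  have key := laplacian_sub_quadratic a b c (ε * √Gd) hn (sphereArea_pos hn).ne' hσ
    (x := sliceL n y) (H := metricInChart h e) (w := fun z => W (e.symm z))
    (u := fun z => -φ (e.symm z)) (by rwa [hx]) (by rw [hx]; exact hφ.neg) heq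
  simp only [hx, gradInner_neg, inChart] at key
  have hf : (fun z => W (e.symm z) ^ 2 - a * (ε * √Gd * -φ (e.symm z) + b) ^ 2 - c)
      = fun z => relationDefect Gd ε a b c W φ (e.symm z) := by
    funext z
    rw [relationDefect]
    ring
  have hf2 : ContDiffAt ℝ 2 (fun z => relationDefect Gd ε a b c W φ (e.symm z)) y := by
    simp only [relationDefect]
    exact ((hreg.self_of_nhds.contDiffAt_w.pow 2).sub (contDiffAt_const.mul
      (((contDiffAt_const.mul hφ).add contDiffAt_const).pow 2))).sub contDiffAt_const
  rw [hf, laplacian_sub_eq_ellipticOp hreg.self_of_nhds hf2,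
    ← inner_spatialGradient he hy hU hyU hs.contMDiffOn_φ] at key
  rw [key, rhoEM]
  ring

/-- Locality of the operator is what the direct implication needs; vanishing at the single point
would not suffice. -/
lemma ellipticOp_eq_zero_of_eventually {A : EuclideanSpace ℝ (Fin n) → Matrix (Fin n) (Fin n) ℝ}
    {β : Fin n → EuclideanSpace ℝ (Fin n) → ℝ} {f : EuclideanSpace ℝ (Fin n) → ℝ}
    (hf : ∀ᶠ z in 𝓝 y, f z = 0) : ellipticOp A β f y = 0 := by
  have h1 : ∀ j, ∀ᶠ z in 𝓝 y, coordDeriv j f z = 0 := fun j => by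
    filter_upwards [hf.eventually_nhds] with z hz
    rw [coordDeriv_congr j (show f =ᶠ[𝓝 z] fun _ => 0 from hz), coordDeriv_const]
  have h2 : ∀ k j, coordDeriv k (coordDeriv j f) y = 0 := fun k j => by
    rw [coordDeriv_congr k (show coordDeriv j f =ᶠ[𝓝 y] fun _ => 0 from h1 j), coordDeriv_const]
  simp [ellipticOp, h2, (h1 _).self_of_nhds]

/-- The strong maximum principle for multiples of `W² - a (-ε √G φ + b)² - c`. -/
lemma relationDefect_eventually_eq_at_max (hn : 3 ≤ n) (ε a b c κ : ℝ) (hGd : 0 < Gd)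
    (hε : ε = 1 ∨ ε = -1) (hU : IsOpen U) (hs : IsStaticChargedFluid Gd h W φ ρm ρe p U)
    (hrel : ∀ q ∈ U, ε * √Gd * (ρm q + (dim n - 1) / (dim n - 3) * p q
      + (1 - a) * rhoEM h W φ q) * W q - a * ρe q * (-ε * √Gd * φ q + b) = 0)
    {q : M} (hq : q ∈ U)
    (hmax : ∀ q' ∈ U, relationDefect Gd ε a b c W φ q' + κ * relationDefect Gd ε a b c W φ q'
      ≤ relationDefect Gd ε a b c W φ q + κ * relationDefect Gd ε a b c W φ q) :
    ∀ᶠ q' in 𝓝 q, relationDefect Gd ε a b c W φ q' + κ * relationDefect Gd ε a b c W φ q'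
      = relationDefect Gd ε a b c W φ q + κ * relationDefect Gd ε a b c W φ q := by
  set e := chartAt (EuclideanSpace ℝ (Fin n)) q with he_def
  have he : e ∈ atlas (EuclideanSpace ℝ (Fin n)) M := chart_mem_atlas _ q
  have hqs : q ∈ e.source := mem_chart_source _ q
  have hqy : e.symm (e q) = q := e.left_inv hqs
  have hreg : ∀ z ∈ e.target ∩ e.symm ⁻¹' U,
      IsRegularAt (metricInChart h e) (fun z => W (e.symm z)) z := fun z hz =>
    isRegularAt_metricInChart he hz.1 hU hz.2 hs
  have hC2 : ∀ z ∈ e.target ∩ e.symm ⁻¹' U,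
      ContDiffAt ℝ 2 (fun z => relationDefect Gd ε a b c W φ (e.symm z)) z := fun z hz => by
    have hφ := contDiffAt_comp_symm he hz.1 hU hz.2 hs.contMDiffOn_φ
    simp only [relationDefect]
    exact (((hreg z hz).contDiffAt_w.pow 2).sub (contDiffAt_const.mul
      (((contDiffAt_const.mul hφ).add contDiffAt_const).pow 2))).sub contDiffAt_const
  have hloc := eventually_eq_of_attains_max (e.symm.isOpen_inter_preimage hU)
    (A := fun z => (metricInChart h e z)⁻¹)
    (β := driftCoeff (metricInChart h e) fun z => W (e.symm z))
    (f := fun z => relationDefect Gd ε a b c W φ (e.symm z)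
      + κ * relationDefect Gd ε a b c W φ (e.symm z))
    (m := relationDefect Gd ε a b c W φ q + κ * relationDefect Gd ε a b c W φ q)
    (fun z hz i j => (contDiffAt_matrix_inv (hreg z hz).contDiffAt_H
      (hreg z hz).isUnit_det i j).continuousAt)
    (fun z hz j => continuousAt_driftCoeff (hreg z hz) j)
    (fun z hz => (hreg z hz).posDef.inv)
    (fun z hz => (hC2 z hz).add (contDiffAt_const.mul (hC2 z hz)))
    (fun z hz => by
      rw [ellipticOp_add_const_mul (hC2 z hz) (hC2 z hz),
        ellipticOp_relationDefect hn ε a b c hGd hε he hz.1 hU hz.2 hs, hrel _ hz.2]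
      ring)
    (fun z hz => hmax _ hz.2)
    (x₀ := e q) ⟨e.map_source hqs, by rwa [Set.mem_preimage, hqy]⟩ (by simp only [hqy])
  filter_upwards [(e.continuousAt hqs).eventually hloc, e.open_source.mem_nhds hqs] with q' h1 h2
  simpa only [e.left_inv h2] using h1

end Charts

end EinsteinMaxwell

end

/-! ### The two implications -/

theorem mainTheorem1 {n : ℕ} (hn : 3 ≤ n)
    {M : Type*} [TopologicalSpace M] [T2Space M] [SecondCountableTopology M] [ConnectedSpace M]
    [ChartedSpace (EuclideanSpace ℝ (Fin n)) M] [IsManifold (𝓡 n) ∞ M]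
    (h : Bundle.RiemannianMetric (fun q : M => TangentSpace (𝓡 n) q))
    (W φ ρm ρe p : M → ℝ)
    (Gd ε a b c : ℝ) (hGd : 0 < Gd) (hε : ε = 1 ∨ ε = -1) :
    -- (i)
    (∀ U : Set M, IsOpen U →
      EinsteinMaxwell.IsStaticChargedFluid Gd h W φ ρm ρe p U →
      (∀ q ∈ U, W q ^ 2 - a * (-ε * √Gd * φ q + b) ^ 2 - c = 0) →
      ∀ q ∈ U,
        a * b * ρe q = ε * √Gd *
          ((ρm q + (EinsteinMaxwell.dim n - 1) / (EinsteinMaxwell.dim n - 3) * p q) * W q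
            + φ q * ρe q + (a - 1) * (φ q * ρe q - W q * EinsteinMaxwell.rhoEM h W φ q)) ∧
        a * ρe q * (-ε * √Gd * φ q + b) = ε * √Gd *
          (ρm q + (EinsteinMaxwell.dim n - 1) / (EinsteinMaxwell.dim n - 3) * p q
            + (1 - a) * EinsteinMaxwell.rhoEM h W φ q) * W q) ∧
    -- (ii)
    (∀ Ω : Set M, IsOpen Ω → IsCompact (closure Ω) → (frontier Ω).Nonempty →
      EinsteinMaxwell.IsStaticChargedFluid Gd h W φ ρm ρe p Ω →
      ContinuousOn W (closure Ω) → ContinuousOn φ (closure Ω) →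
      (∀ q ∈ Ω,
        a * b * ρe q = ε * √Gd *
          ((ρm q + (EinsteinMaxwell.dim n - 1) / (EinsteinMaxwell.dim n - 3) * p q) * W q
            + φ q * ρe q + (a - 1) * (φ q * ρe q - W q * EinsteinMaxwell.rhoEM h W φ q))) →
      (∀ q ∈ frontier Ω, W q ^ 2 - a * (-ε * √Gd * φ q + b) ^ 2 - c = 0) →
      ∀ q ∈ Ω, W q ^ 2 = a * (-ε * √Gd * φ q + b) ^ 2 + c) := by
  refine ⟨fun U hU hs hrel q hq => ?_, fun Ω hΩ hc hfr hs hW hφ hrel hbd => ?_⟩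
  · have hσ : ε * √Gd ≠ 0 := mul_ne_zero (by rcases hε with rfl | rfl <;> norm_num)
      (Real.sqrt_pos.2 hGd).ne'
    set e := chartAt (EuclideanSpace ℝ (Fin n)) q
    have he : e ∈ atlas (EuclideanSpace ℝ (Fin n)) M := chart_mem_atlas _ q
    have hqs : q ∈ e.source := mem_chart_source _ q
    have hqy : e.symm (e q) = q := e.left_inv hqs
    have hyU : e.symm (e q) ∈ U := by rwa [hqy]
    have key := EinsteinMaxwell.ellipticOp_relationDefect hn ε a b c hGd hε he
      (e.map_source hqs) hU hyU hs
    rw [EinsteinMaxwell.ellipticOp_eq_zero_of_eventually, hqy] at key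
    · have hpos := mul_pos (mul_pos two_pos (EinsteinMaxwell.sphereArea_pos hn)) (hs.pos q hq)
      -- The prefactor 2 S W σ is nonzero, so the source defect vanishes; both displayed forms are
      -- rearrangements of that one equation.
      have h0 := (mul_eq_zero.1 key.symm).resolve_left (mul_ne_zero hpos.ne' hσ)
      constructor <;> linear_combination -h0
    · filter_upwards [(e.symm.isOpen_inter_preimage hU).mem_nhds ⟨e.map_source hqs, hyU⟩]
        with z hz using hrel _ hz.2
  -- The factor 1 + κ covers both signs at once: κ = 0 bounds the defect itself and κ = -2 bounds
  -- its negative.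
  · have h0 : ∀ κ : ℝ, ∀ q ∈ Ω, EinsteinMaxwell.relationDefect Gd ε a b c W φ q
        + κ * EinsteinMaxwell.relationDefect Gd ε a b c W φ q ≤ 0 := fun κ => by
      have hcont : ContinuousOn (EinsteinMaxwell.relationDefect Gd ε a b c W φ) (closure Ω) := by
        unfold EinsteinMaxwell.relationDefect
        exact ((hW.pow 2).sub (continuousOn_const.mul
          (((continuousOn_const.mul hφ).add continuousOn_const).pow 2))).sub continuousOn_const
      refine EinsteinMaxwell.nonpos_of_eventually_eq_at_max hΩ hc hfr
        (hcont.add (continuousOn_const.mul hcont)) (fun q hq => ?_) fun q hq hmax =>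
          EinsteinMaxwell.relationDefect_eventually_eq_at_max hn ε a b c κ hGd hε hΩ hs
            (fun q hq => ?_) hq hmax
      · have : EinsteinMaxwell.relationDefect Gd ε a b c W φ q = 0 := hbd q hq
        rw [this]
        ring
      · linear_combination -hrel q hq
    intro q hq
    have h1 := h0 0 q hq
    have h2 := h0 (-2) q hq
    simp only [EinsteinMaxwell.relationDefect] at h1 h2
    linarith
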